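/- Let $T$ be a complete first-order theory in a language $\mathcal L$ of arbitrary cardinality, and let $\mathbb O\models T$ be a monster model: $\mathbb O$ is $\kappa$-saturated for some $\kappa>|\mathcal L|+\aleph_0$. A model $M\preceq\mathbb O$ is small if $|M|<\kappa$; $x,y,z$ are finite tuples of variables, and global types are complete types over $\mathbb O$. Definitions. (i) In the binary tree $2^{<\omega}$, ordered by extension $\trianglelefteq$, the right-combs form the least class of sets that contains all sets of cardinality at most $1$ and contains $X$ whenever for some $\sigma$ every element of $X$ properly extends $\sigma$, exactly one element of $X$ extends $\sigma\frown 0$, and the set of elements of $X$ extending $\sigma\frown1$ is a right-comb. $T$ has $k$-CTP if there are an $\mathcal L$-formula $\varphi(x,y)$ and tuples $(b_\sigma)_{\sigma\in2^{<\omega}}$ in a model of $T$ such that for every $\alpha\in2^\omega$ the family $(\varphi(x,b_{\alpha\restriction n}))_{n<\omega}$ is $k$-inconsistent (no $k$ members with distinct indices are jointly satisfiable), while $\{\varphi(x,b_\sigma):\sigma\in X\}$ is consistent for every right-comb $X$. $T$ has CTP (the comb tree property) if it has $k$-CTP for some $k<\omega$, and is NCTP otherwise. (ii) Let $p(y)$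 be a global type and $M\preceq\mathbb O$ small. $p$ is an $M$-coheir if it is finitely satisfiable in $M$; an $M$-heir if for each formula $\psi(y,z)$ with parameters in $M$ such that $\psi(y,b)\in p$ for some $b$ in $\mathbb O$, there is $c$ in $M$ with $\psi(y,c)\in p$; an $M$-heir-coheir if it is both. $p$ is $M$-invariant if for all $\mathcal L$-formulas $\psi(y,z)$ and all $b\equiv_M b'$, $\psi(y,b)\in p\iff\psi(y,b')\in p$; it is $M$-bi-invariant if it is $M$-invariant and, for all finite tuples $a,b$ with $a\models p\restriction Mb$, $\operatorname{tp}(b/Ma)$ extends to a global $M$-invariant type. (iii) A Morley sequence generated by $p$ over $M$ is a sequence $(e_i)_{i<\omega}$ with $e_i\models p\restriction M e_{<i}$ for all $i$. An $\mathcal L$-formula $\varphi(x,y)$ $p$-Kim-divides (over $M$) if $\{\varphi(x,e_i):i<\omega\}$ is inconsistent for some Morley sequence $(e_i)_{i<\omega}$ generated by $p$ over $M$ (for $M$-invariant $p$, equivalently for every one). Theorem. $T$ has CTP if and only if there are a small model $M\preceq\mathbb O$, an $\mathcal L$-formula $\varphi(x,y)$, an $M$-heir-coheir $p(y)$ and an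 $M$-coheir $q(y)$ such that $p\restriction M=q\restriction M$ and $\varphi(x,y)$ $q$-Kim-divides but does not $p$-Kim-divide. In other words, $T$ is NCTP if and only if Kim's lemma holds for heir-coheirs: for all small $M\preceq\mathbb O$, all $\varphi(x,y)$, every $M$-heir-coheir $p(y)$ and every $M$-coheir $q(y)$ with $p\restriction M=q\restriction M$, if $\varphi(x,y)$ $q$-Kim-divides then it $p$-Kim-divides. Moreover, $T$ is NCTP if and only if Kim's lemma holds for bi-invariant types: the same implication holds for all small $M\preceq\mathbb O$, all $\varphi(x,y)$, every $M$-bi-invariant $p(y)$ and every $M$-invariant $q(y)$ with $p\restriction M=q\restriction M$. -/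

import Mathlib

open Cardinal FirstOrder FirstOrder.Language

universe u v w

namespace CombTree

/-! ### Consistency of instances of a formula, and the comb tree property -/

section Trees

variable {L : FirstOrder.Language.{u, v}} {N : Type w} [L.Structure N] {ι : Type*} {n m : ℕ}

/-- The finite family `{φ(x, b i) : i ∈ s}` of instances of `φ(x, y)` has a common solution in `N`. -/
def HasSolution (φ : L.Formula (Fin n ⊕ Fin m)) (b : ι → Fin m → N) (s : Finset ι) : Prop :=
  ∃ a : Fin n → N, ∀ i ∈ s, φ.Realize (Sum.elim a (b i))

/-- `{φ(x, b i) : i ∈ X}` is consistent (with the elementary diagram of `N`): every finite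
subfamily has a solution in `N`. -/
def Consistent (φ : L.Formula (Fin n ⊕ Fin m)) (b : ι → Fin m → N) (X : Set ι) : Prop :=
  ∀ s : Finset ι, (s : Set ι) ⊆ X → HasSolution φ b s

/-- The indexed family `{φ(x, b i) : i ∈ X}` is `k`-inconsistent: no subfamily given by `k`
distinct indices has a solution. -/
def KInconsistent (k : ℕ) (φ : L.Formula (Fin n ⊕ Fin m)) (b : ι → Fin m → N) (X : Set ι) :
    Prop :=
  ∀ s : Finset ι, (s : Set ι) ⊆ X → s.card = k → ¬ HasSolution φ b s

/-- The nodes of the full binary tree of finite 0-1 sequences lying (weakly) above `σ`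
(`false` is `0` and `true` is `1`). -/
def cone (σ : List Bool) : Set (List Bool) := {τ | σ <+: τ}

/-- Right-combs in the full binary tree: the least class of sets of nodes containing the sets of
cardinality at most one and such that `X` is in the class whenever there is a node `σ` with
`X` contained in the nodes strictly above `σ`, exactly one element of `X` above `σ⌢0`, and the part
of `X` above `σ⌢1` in the class. -/
inductive RightComb : Set (List Bool) → Prop
  | small (X : Set (List Bool)) (hX : X.encard ≤ 1) : RightComb X
  | step (X : Set (List Bool)) (σ : List Bool) (hX : X ⊆ cone σ \ {σ})
      (h0 : (X ∩ cone (σ ++ [false])).encard = 1)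
      (h1 : RightComb (X ∩ cone (σ ++ [true]))) : RightComb X

/-- The initial segment `α↾i` of an infinite 0-1 sequence `α`. -/
def initSeg (α : ℕ → Bool) (i : ℕ) : List Bool := List.ofFn fun j : Fin i => α j

/-- The formula `φ(x, y)` and the tree `b` witness `k`-CTP in the structure `N`. -/
def IsCTPWitness (k : ℕ) (φ : L.Formula (Fin n ⊕ Fin m)) (b : List Bool → Fin m → N) : Prop :=
  (∀ α : ℕ → Bool, KInconsistent k φ (fun i => b (initSeg α i)) Set.univ) ∧
    ∀ X : Set (List Bool), RightComb X → Consistent φ b X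

/-- `T` has `k`-CTP: some formula `φ(x, y)` (in finite tuples of variables `x`, `y`, without
parameters) and some tree of tuples in a model of `T` witness it. -/
def HasKCTP (T : L.Theory) (k : ℕ) : Prop :=
  ∃ (N : Theory.ModelType.{u, v, max u v} T) (n m : ℕ) (φ : L.Formula (Fin n ⊕ Fin m))
    (b : List Bool → Fin m → N), IsCTPWitness k φ b

/-- The comb tree property. -/
def HasCTP (T : L.Theory) : Prop := ∃ k : ℕ, HasKCTP T k

end Trees

/-! ### Global types over a fixed big model `U` -/

section Types

variable (L : FirstOrder.Language.{u, v}) (U : Type w) [L.Structure U]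

/-- `U` is `κ`-saturated: every complete type in finitely many variables over a set of
fewer than `κ` parameters from `U` is realized in `U`. -/
def IsSaturated [Nonempty U] (κ : Cardinal.{w}) : Prop :=
  ∀ A : Set U, #A < κ → ∀ (n : ℕ) (p : (L[[A]].completeTheory U).CompleteType (Fin n)),
    p ∈ (L[[A]].completeTheory U).realizedTypes U (Fin n)

/-- A global type `p(y)` in an `m`-tuple of variables: a complete type over the whole of `U`. -/
abbrev GlobalType (m : ℕ) : Type (max u v w) := (L.elementaryDiagram U).CompleteType (Fin m)

variable {L U}

/-- The `L(U)`-formula `φ(x, b)` obtained from the `L`-formula `φ(x, y)` by substituting the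
parameters `b` for `y`. -/
def substParams {α β : Type*} (φ : L.Formula (α ⊕ β)) (b : β → U) : L[[U]].Formula α :=
  BoundedFormula.constantsVarsEquiv.symm
    (φ.relabel (Sum.elim Sum.inr (fun i => Sum.inl (b i)) : α ⊕ β → U ⊕ α))

theorem realize_substParams {α β : Type*} (φ : L.Formula (α ⊕ β)) (b : β → U) (a : α → U) :
    (substParams φ b).Realize a ↔ φ.Realize (Sum.elim a b) := by
  unfold substParams Formula.Realize
  rw [← BoundedFormula.realize_constantsVarsEquiv, Equiv.apply_symm_apply]
  change (Formula.relabel _ φ).Realize _ ↔ φ.Realize _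
  rw [Formula.realize_relabel]
  have h : (Sum.elim (fun a => ((L.con a : L[[U]].Constants) : U)) a ∘
      (Sum.elim Sum.inr (fun i => Sum.inl (b i)) : α ⊕ β → U ⊕ α)) = Sum.elim a b := by
    funext x
    rcases x with x | x
    · rfl
    · rfl
  rw [h]

namespace GlobalType

variable {m : ℕ}

/-- `φ(y, b) ∈ p(y)`, for an `L`-formula `φ(y, z)` and parameters `b` from `U`. Every formula over
`U` is of this form. -/
def Holds {β : Type*} (p : GlobalType L U m) (φ : L.Formula (Fin m ⊕ β)) (b : β → U) : Prop :=
  Formula.equivSentence (substParams φ b) ∈ p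

/-- `a ⊨ p↾A`. -/
def Realizes (p : GlobalType L U m) (A : Set U) (a : Fin m → U) : Prop :=
  ∀ (l : ℕ) (φ : L.Formula (Fin m ⊕ Fin l)) (c : Fin l → U), (∀ i, c i ∈ A) →
    p.Holds φ c → φ.Realize (Sum.elim a c)

/-- `p↾A = q↾A`. -/
def EqOn (p q : GlobalType L U m) (A : Set U) : Prop :=
  ∀ (l : ℕ) (φ : L.Formula (Fin m ⊕ Fin l)) (c : Fin l → U), (∀ i, c i ∈ A) →
    (p.Holds φ c ↔ q.Holds φ c)

/-- `p` is a coheir over `A`: every formula over `U` in `p` is satisfied by a tuple from `A`. -/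
def IsCoheir (A : Set U) (p : GlobalType L U m) : Prop :=
  ∀ (l : ℕ) (φ : L.Formula (Fin m ⊕ Fin l)) (b : Fin l → U), p.Holds φ b →
    ∃ a : Fin m → U, (∀ i, a i ∈ A) ∧ φ.Realize (Sum.elim a b)

/-- `p` is an heir over `A`: for every formula `φ(y, z, c)` with parameters `c` from `A`, if
`φ(y, b, c) ∈ p` for some `b` in `U`, then `φ(y, b', c) ∈ p` for some `b'` in `A`. -/
def IsHeir (A : Set U) (p : GlobalType L U m) : Prop :=
  ∀ (l r : ℕ) (φ : L.Formula (Fin m ⊕ (Fin l ⊕ Fin r))) (c : Fin r → U), (∀ i, c i ∈ A) →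
    (∃ b : Fin l → U, p.Holds φ (Sum.elim b c)) →
      ∃ b' : Fin l → U, (∀ i, b' i ∈ A) ∧ p.Holds φ (Sum.elim b' c)

/-- `p` is an heir-coheir over `A`. -/
def IsHeirCoheir (A : Set U) (p : GlobalType L U m) : Prop := IsHeir A p ∧ IsCoheir A p

end GlobalType

/-- The `n`-tuples `b` and `b'` have the same type over `A`. -/
def SameTypeOver (L : FirstOrder.Language.{u, v}) [L.Structure U] (A : Set U) {n : ℕ} (b b' : Fin n → U) :
    Prop :=
  ∀ (l : ℕ) (φ : L.Formula (Fin n ⊕ Fin l)) (c : Fin l → U), (∀ i, c i ∈ A) →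
    (φ.Realize (Sum.elim b c) ↔ φ.Realize (Sum.elim b' c))

namespace GlobalType

variable {m : ℕ}

/-- `p` is `A`-invariant: whether `φ(y, b)` belongs to `p` depends only on `φ` and on the type of
`b` over `A`. -/
def IsInvariant (A : Set U) (p : GlobalType L U m) : Prop :=
  ∀ (n : ℕ) (φ : L.Formula (Fin m ⊕ Fin n)) (b b' : Fin n → U), SameTypeOver L A b b' →
    (p.Holds φ b ↔ p.Holds φ b')

/-- `p` is `A`-bi-invariant: it is `A`-invariant and whenever `a ⊨ p↾Ab`, the type of `b` over `Aa`
extends to a global `A`-invariant type. -/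
def IsBiInvariant (A : Set U) (p : GlobalType L U m) : Prop :=
  IsInvariant A p ∧
    ∀ (n : ℕ) (a : Fin m → U) (b : Fin n → U), p.Realizes (A ∪ Set.range b) a →
      ∃ r : GlobalType L U n, r.IsInvariant A ∧ r.Realizes (A ∪ Set.range a) b

/-- `e` is a Morley sequence generated by `p` over `A`: `e i ⊨ p↾A(e j : j < i)` for all `i`. -/
def IsMorley (A : Set U) (p : GlobalType L U m) (e : ℕ → Fin m → U) : Prop :=
  ∀ i : ℕ, p.Realizes (A ∪ ⋃ j < i, Set.range (e j)) (e i)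

/-- `φ(x, y)` `p`-Kim-divides (over `A`): `{φ(x, e i) : i < ω}` is inconsistent for some Morley
sequence `e` generated by `p` over `A`. (For `p` invariant over `A`, all Morley sequences generated
by `p` over `A` have the same type over `A`, so "some" may equally be read as "every".) -/
def KimDivides (A : Set U) (p : GlobalType L U m) {n : ℕ} (φ : L.Formula (Fin n ⊕ Fin m)) :
    Prop :=
  ∃ e : ℕ → Fin m → U, p.IsMorley A e ∧ ¬ Consistent φ e Set.univ

end GlobalType

end Types

end CombTree

namespace CombTree

/-! ### Definable sets and their fibres -/

section Definability

variable {L : FirstOrder.Language.{u, v}} {U : Type w} [L.Structure U]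

/-! Global types are handled as ultrafilters on tuples (`exists_ultrafilter_represents`,
`exists_globalType_of_ultrafilter`), of which only the definable members matter.

From a failure of Kim's lemma to CTP. Let p be bi-invariant and q invariant with p = q over M, where
φ q-Kim-divides but does not p-Kim-divide. There are trees of every finite height in which each node
realizes q over the nodes above it, and everything above σ⌢0 realizes p over the nodes above σ⌢1
(`exists_goodTree`). Given such a tree b, take a ⊨ p↾Mb. Bi-invariance extends tp(b/Ma) to an
invariant type r, and c ⊨ r↾Mb is a copy of b. Every node of b has the type of a over M, so it
stands to c as a stands to b; hence b can be the left half and c the right half, under a new root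
realizing q. Chains are then reversed q-Morley sequences and combs are reversed p-Morley sequences.
By invariance their consistency depends only on their length, and compactness yields an infinite
tree. Heir-coheirs are covered because the heir property makes tp(b/Ma) finitely satisfiable in M
(`GlobalType.IsHeirCoheir.isBiInvariant`).

From CTP to a failure. Split a tree into its root, left half and right half. The right half is still
a comb tree when the root is prepended to its chains and any one node of the left half to its combs
(`IsCombTree.right`). Iterating produces roots a_j and left halves B_j. The type q comes from a
nonprincipal ultrafilter on the a_j, the type p from an ultrafilter D on the nodes of the B_j, and
the behaviour of lists of such tuples passes to Morley sequences (`MorleyList.solvable_append_iff`).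

To make p an heir, the tree is replaced before each split by one satisfying a maximal set of
instances R(y, b), with at most one b for each R over the current parameters
(`exists_maximal_isAdmissible`). These b join the parameters, whose union M has size at most |L| +
ℵ₀. The ultrafilter D is chosen so that each of its members contains a tree relative to every stage;
this is possible because the sets without such a tree form an ideal, by a partition property of the
binary tree (`exists_treeEmbedding_mem_or_append`). If R(y, b) is in p, some tree lies in R(y, b),
so by maximality R(y, b') was imposed for some b' in M, and it holds on all later B_j and a_j. This
makes p an heir, and it also gives p = q over M. -/

theorem definable_iff_exists_params {α : Type*} {A : Set U} {s : Set (α → U)} :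
    A.Definable L s ↔ ∃ (l : ℕ) (φ : L.Formula (α ⊕ Fin l)) (c : Fin l → U),
      (∀ i, c i ∈ A) ∧ s = {a | φ.Realize (Sum.elim a c)} := by
  constructor
  · intro h
    obtain ⟨A0, hA0, h⟩ := Set.definable_iff_finitely_definable.1 h
    obtain ⟨φ, rfl⟩ := Set.definable_iff_exists_formula_sum.1 h
    let e := Fintype.equivFin (A0 : Set U)
    refine ⟨_, φ.relabel (Sum.elim (fun x => Sum.inr (e x)) Sum.inl), fun i => (e.symm i : U),
      fun i => hA0 (e.symm i).2, ?_⟩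
    ext a
    simp only [Set.mem_ofPred_eq, Formula.realize_relabel]
    have : (Sum.elim a (fun i => (e.symm i : U)) ∘ Sum.elim (fun x => Sum.inr (e x)) Sum.inl)
        = Sum.elim (fun x : (A0 : Set U) => (x : U)) a := by
      funext x
      rcases x with x | x
      · simp
      · rfl
    rw [this]
  · rintro ⟨l, φ, c, hc, rfl⟩
    rw [Set.definable_iff_exists_formula_sum]
    refine ⟨φ.relabel (Sum.elim Sum.inr fun i => Sum.inl ⟨c i, hc i⟩), ?_⟩
    ext a
    simp only [Set.mem_ofPred_eq, Formula.realize_relabel]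
    have : (Sum.elim (fun x : A => (x : U)) a ∘ Sum.elim Sum.inr fun i => Sum.inl ⟨c i, hc i⟩)
        = Sum.elim a c := by
      funext x
      rcases x with x | x <;> rfl
    rw [this]

theorem definable_subst {α γ : Type*} {A : Set U} {S : Set (γ → U)} (hS : A.Definable L S)
    (g : γ → α ⊕ A) :
    A.Definable L {v : α → U | (fun i => Sum.elim v (fun x : A => (x : U)) (g i)) ∈ S} := by
  obtain ⟨φ, rfl⟩ := Set.definable_iff_exists_formula_sum.1 hS
  rw [Set.definable_iff_exists_formula_sum]
  refine ⟨φ.relabel (Sum.elim Sum.inl fun i => (g i).swap), ?_⟩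
  ext a
  simp only [Set.mem_ofPred_eq, Formula.realize_relabel]
  have : (Sum.elim (fun x : A => (x : U)) a ∘ Sum.elim Sum.inl fun i => (g i).swap)
      = Sum.elim (fun x : A => (x : U)) (fun i => Sum.elim a (fun x : A => (x : U)) (g i)) := by
    funext x
    rcases x with x | x
    · rfl
    · simp only [Function.comp_apply, Sum.elim_inr]
      rcases g x with y | y <;> rfl
  rw [this]

theorem definable_slice {α β : Type*} {A B : Set U} {R : Set (α ⊕ β → U)}
    (hR : A.Definable L R) (hAB : A ⊆ B) {b : β → U} (hb : ∀ i, b i ∈ B) :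
    B.Definable L {a : α → U | Sum.elim a b ∈ R} := by
  have := definable_subst (hR.mono hAB)
    (Sum.elim Sum.inl (fun i => Sum.inr ⟨b i, hb i⟩) : α ⊕ β → α ⊕ B)
  convert this using 4
  rename_i a
  funext i
  rcases i with i | i <;> rfl

/-- Converse of `definable_slice`: separates the parameters in b from those in A, so that invariance
over A can be applied to the relation R. -/
theorem exists_slice {α β : Type*} {A : Set U} {b : β → U} {Z : Set (α → U)}
    (hZ : (A ∪ Set.range b).Definable L Z) :
    ∃ R : Set (α ⊕ β → U), A.Definable L R ∧ Z = {a | Sum.elim a b ∈ R} := by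
  classical
  obtain ⟨l, φ, c, hc, rfl⟩ := definable_iff_exists_params.1 hZ
  have h0 : A.Definable L {v : α ⊕ Fin l → U | φ.Realize v} :=
    (Set.empty_definable_iff.2 ⟨φ, rfl⟩).mono (Set.empty_subset _)
  have hc' : ∀ i, ∃ g : (α ⊕ β) ⊕ A, ∀ a : α → U,
      Sum.elim (Sum.elim a b) (fun x : A => (x : U)) g = c i := by
    intro i
    rcases hc i with h | ⟨j, h⟩
    · exact ⟨Sum.inr ⟨_, h⟩, fun _ => rfl⟩
    · exact ⟨Sum.inl (Sum.inr j), fun _ => h⟩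
  choose g hg using hc'
  refine ⟨_, definable_subst h0 (Sum.elim (fun i => Sum.inl (Sum.inl i)) g), ?_⟩
  ext a
  simp only [Set.mem_ofPred_eq]
  have : (fun i => Sum.elim (Sum.elim a b) (fun x : A => (x : U))
      ((Sum.elim (fun i => Sum.inl (Sum.inl i)) g : α ⊕ Fin l → (α ⊕ β) ⊕ A) i))
      = Sum.elim a c := by
    funext i
    rcases i with i | i
    · rfl
    · exact hg i a
  rw [this]

theorem definable_realize {γ : Type*} (A : Set U) (φ : L.Formula γ) :
    A.Definable L {v : γ → U | φ.Realize v} :=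
  (Set.empty_definable_iff.2 ⟨φ, rfl⟩).mono (Set.empty_subset _)

theorem definable_realize_elim {α β : Type*} {A : Set U} (φ : L.Formula (α ⊕ β)) {b : β → U}
    (hb : ∀ i, b i ∈ A) : A.Definable L {a : α → U | φ.Realize (Sum.elim a b)} :=
  definable_slice (definable_realize A φ) subset_rfl hb

end Definability

/-! ### Complete types as ultrafilters on tuples -/

section Ultrafilters

/-- By Łoś's theorem, the type is that of the coordinate functions in the ultrapower of N along D.
-/
theorem exists_type_of_ultrafilter (L : FirstOrder.Language.{u, v}) (N : Type w) [L.Structure N]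
    [Nonempty N] {α : Type} (D : Ultrafilter (α → N)) :
    ∃ p : (L.completeTheory N).CompleteType α, ∀ F : L.Formula α,
      Formula.equivSentence F ∈ p ↔ {a | F.Realize a} ∈ D := by
  let P := (D : Filter (α → N)).Product fun _ => N
  have : P ⊨ L.completeTheory N := by
    rw [Theory.model_iff]
    intro σ hσ
    exact (Ultraproduct.sentence_realize (M := fun _ => N) (u := D) σ).2
      (Filter.Eventually.of_forall fun _ => hσ)
  refine ⟨(L.completeTheory N).typeOf (M := P) fun i =>
    (((fun a : α → N => a i) : (α → N) → N) : P), fun F => Theory.CompleteType.formula_mem_typeOf.trans ?_⟩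
  exact Ultraproduct.realize_formula_cast (M := fun _ => N) (u := D) F (fun i a => a i)

/-- Realize p by v in a model K of the complete theory of N. Each formula true of v has a solution
in N, since its existential closure passes from K to N; so the solution sets generate a proper
filter. -/
theorem exists_ultrafilter_of_type {L : FirstOrder.Language.{u, v}} {N : Type w} [L.Structure N]
    [Nonempty N] {α : Type} [Finite α] (p : (L.completeTheory N).CompleteType α) :
    ∃ D : Ultrafilter (α → N), ∀ F : L.Formula α,
      Formula.equivSentence F ∈ p ↔ {a | F.Realize a} ∈ D := by
  obtain ⟨K, v, rfl⟩ := Theory.exists_modelType_is_realized_in _ p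
  let S : Set (Set (α → N)) := {s | ∃ F : L.Formula α, F.Realize v ∧ s = {a | F.Realize a}}
  have hS : (Filter.generate S).NeBot := by
    rw [Filter.generate_neBot_iff]
    intro t ht hfin
    have key : ∃ F : L.Formula α, F.Realize v ∧ {a | F.Realize a} ⊆ ⋂₀ t := by
      induction t, hfin using Set.Finite.induction_on with
      | empty => exact ⟨⊤, by simp, by simp⟩
      | @insert s t _ _ ih =>
        obtain ⟨F, hF, hFt⟩ := ih ((Set.subset_insert _ _).trans ht)
        obtain ⟨G, hG, rfl⟩ := ht (Set.mem_insert _ _)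
        refine ⟨F ⊓ G, Formula.realize_inf.2 ⟨hF, hG⟩, ?_⟩
        intro a ha
        have ha := Formula.realize_inf.1 ha
        rw [Set.sInter_insert]
        exact ⟨ha.2, hFt ha.1⟩
    obtain ⟨F, hF, hFt⟩ := key
    have h1 : K ⊨ ((F.relabel Sum.inr : L.Formula (Empty ⊕ α)).iExs α) := by
      refine Formula.realize_iExs.2 ⟨v, ?_⟩
      rw [Formula.realize_relabel]
      exact hF
    have h2 := ((completeTheory.isMaximal L N).isComplete.realize_sentence_iff _ K).1 h1
    have h3 : N ⊨ ((F.relabel Sum.inr : L.Formula (Empty ⊕ α)).iExs α) :=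
      h2.realize_sentence N
    obtain ⟨a, ha⟩ := Formula.realize_iExs.1 h3
    rw [Formula.realize_relabel] at ha
    exact ⟨a, hFt ha⟩
  let D := Ultrafilter.of (Filter.generate S)
  have hD : ∀ F : L.Formula α, F.Realize v → {a | F.Realize a} ∈ D := fun F hF =>
    Ultrafilter.of_le _ (Filter.mem_generate_of_mem ⟨F, hF, rfl⟩)
  refine ⟨D, fun F => ?_⟩
  rw [Theory.CompleteType.formula_mem_typeOf]
  refine ⟨hD F, fun h => ?_⟩
  by_contra hF
  have h' := hD F.not hF
  refine (Ultrafilter.compl_notMem_iff.2 h) ?_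
  exact h'

end Ultrafilters

section GlobalTypes

variable {L : FirstOrder.Language.{u, v}} {U : Type w} [L.Structure U] {m : ℕ}

/-- The ultrafilter `D` on `m`-tuples represents the global type `p`. -/
def Represents (D : Ultrafilter (Fin m → U)) (p : GlobalType L U m) : Prop :=
  ∀ (β : Type) (φ : L.Formula (Fin m ⊕ β)) (b : β → U),
    p.Holds φ b ↔ {a | φ.Realize (Sum.elim a b)} ∈ D

theorem exists_globalType_of_ultrafilter [Nonempty U] (D : Ultrafilter (Fin m → U)) :
    ∃ p : GlobalType L U m, Represents D p := by
  obtain ⟨p, hp⟩ := exists_type_of_ultrafilter L[[U]] U D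
  refine ⟨p, fun β φ b => (hp _).trans ?_⟩
  simp only [realize_substParams]

theorem exists_ultrafilter_represents [Nonempty U] (p : GlobalType L U m) :
    ∃ D : Ultrafilter (Fin m → U), Represents D p := by
  obtain ⟨D, hD⟩ := exists_ultrafilter_of_type (L := L[[U]]) (N := U) p
  refine ⟨D, fun β φ b => (hD _).trans ?_⟩
  simp only [realize_substParams]

end GlobalTypes

/-! ### Invariance and realization for ultrafilters -/

section UltrafilterTypes

variable (L : FirstOrder.Language.{u, v}) {U : Type w} [L.Structure U] {α β : Type}

/-- Two tuples satisfy the same `A`-definable relations. -/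
def SameType (A : Set U) (b b' : β → U) : Prop :=
  ∀ Z : Set (β → U), A.Definable L Z → (b ∈ Z ↔ b' ∈ Z)

/-- The tuple `a` lies in every `A`-definable set belonging to `D`. -/
def URealizes (D : Ultrafilter (α → U)) (A : Set U) (a : α → U) : Prop :=
  ∀ Z : Set (α → U), A.Definable L Z → Z ∈ D → a ∈ Z

/-- The global type of the ultrafilter `D` is invariant over `A`. -/
def UInvariant (D : Ultrafilter (α → U)) (A : Set U) : Prop :=
  ∀ (β : Type) [Finite β] (R : Set (α ⊕ β → U)), A.Definable L R → ∀ b b' : β → U,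
    SameType L A b b' → ({a | Sum.elim a b ∈ R} ∈ D ↔ {a | Sum.elim a b' ∈ R} ∈ D)

variable {L}

theorem SameType.symm {A : Set U} {b b' : β → U} (h : SameType L A b b') : SameType L A b' b :=
  fun Z hZ => (h Z hZ).symm

theorem SameType.comp {γ : Type} {A : Set U} {b b' : β → U} (h : SameType L A b b') (f : γ → β) :
    SameType L A (b ∘ f) (b' ∘ f) :=
  fun _ hZ => h _ (hZ.preimage_comp f)

theorem URealizes.iff {D : Ultrafilter (α → U)} {A : Set U} {a : α → U} (h : URealizes L D A a)
    {Z : Set (α → U)} (hZ : A.Definable L Z) : a ∈ Z ↔ Z ∈ D := by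
  refine ⟨fun ha => ?_, h Z hZ⟩
  by_contra hn
  exact h _ hZ.compl (Ultrafilter.compl_mem_iff_notMem.2 hn) ha

theorem URealizes.mono {D : Ultrafilter (α → U)} {A B : Set U} {a : α → U}
    (h : URealizes L D B a) (hAB : A ⊆ B) : URealizes L D A a :=
  fun Z hZ => h Z (hZ.mono hAB)

theorem URealizes.sameType {D : Ultrafilter (α → U)} {A : Set U} {a a' : α → U}
    (h : URealizes L D A a) (h' : URealizes L D A a') : SameType L A a a' :=
  fun _ hZ => (h.iff hZ).trans (h'.iff hZ).symm

/-- Whether a relation R holds of (a, b) is decided by whether the fibre of R at b is D-large, which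
by invariance depends only on the type of b over A. -/
theorem UInvariant.sameType_elim [Finite β] {D : Ultrafilter (α → U)} {A : Set U}
    (hD : UInvariant L D A) {a a' : α → U} {b b' : β → U}
    (h : URealizes L D (A ∪ Set.range b) a) (h' : URealizes L D (A ∪ Set.range b') a')
    (hb : SameType L A b b') : SameType L A (Sum.elim a b) (Sum.elim a' b') := by
  intro R hR
  have h1 := h.iff (definable_slice hR Set.subset_union_left (b := b)
    fun i => Or.inr (Set.mem_range_self i))
  have h2 := h'.iff (definable_slice hR Set.subset_union_left (b := b')
    fun i => Or.inr (Set.mem_range_self i))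
  exact h1.trans ((hD β R hR b b' hb).trans h2.symm)

/-- For invariant D, realizing D over A and b is a property of the type of (a, b) over A; this moves
configurations to their conjugates. -/
theorem UInvariant.realizes_of_sameType [Finite β] {D : Ultrafilter (α → U)} {A : Set U}
    (hD : UInvariant L D A) {a a' : α → U} {b b' : β → U}
    (h : URealizes L D (A ∪ Set.range b) a)
    (hab : SameType L A (Sum.elim a b) (Sum.elim a' b')) :
    URealizes L D (A ∪ Set.range b') a' := by
  intro Z hZ hZD
  obtain ⟨R, hR, rfl⟩ := exists_slice hZ
  have hb : SameType L A b b' := hab.comp Sum.inr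
  have h1 := (hD β R hR b b' hb).2 hZD
  exact (hab R hR).1 (h _ (definable_slice hR Set.subset_union_left
    fun i => Or.inr (Set.mem_range_self i)) h1)

end UltrafilterTypes

/-! ### Translation between global types and ultrafilters -/

section Translation

variable {L : FirstOrder.Language.{u, v}} {U : Type w} [L.Structure U] {m : ℕ}

theorem sameTypeOver_iff {A : Set U} {n : ℕ} {b b' : Fin n → U} :
    SameTypeOver L A b b' ↔ SameType L A b b' := by
  constructor
  · intro h Z hZ
    obtain ⟨l, φ, c, hc, rfl⟩ := definable_iff_exists_params.1 hZ
    exact h l φ c hc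
  · intro h l φ c hc
    exact h _ (definable_realize_elim φ hc)

namespace Represents

variable {D : Ultrafilter (Fin m → U)} {p : GlobalType L U m} {A : Set U}

theorem realizes_iff (h : Represents D p) {a : Fin m → U} :
    p.Realizes A a ↔ URealizes L D A a := by
  constructor
  · intro ha Z hZ hZD
    obtain ⟨l, φ, c, hc, rfl⟩ := definable_iff_exists_params.1 hZ
    exact ha l φ c hc ((h _ _ _).2 hZD)
  · intro ha l φ c hc hp
    exact ha _ (definable_realize_elim φ hc) ((h _ _ _).1 hp)

theorem eqOn_iff (h : Represents D p) {E : Ultrafilter (Fin m → U)} {q : GlobalType L U m}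
    (h' : Represents E q) :
    p.EqOn q A ↔ ∀ Z : Set (Fin m → U), A.Definable L Z → (Z ∈ D ↔ Z ∈ E) := by
  constructor
  · intro hpq Z hZ
    obtain ⟨l, φ, c, hc, rfl⟩ := definable_iff_exists_params.1 hZ
    exact (h _ _ _).symm.trans ((hpq l φ c hc).trans (h' _ _ _))
  · intro hDE l φ c hc
    exact (h _ _ _).trans ((hDE _ (definable_realize_elim φ hc)).trans (h' _ _ _).symm)

theorem isCoheir_iff (h : Represents D p) :
    p.IsCoheir A ↔ ∀ Z : Set (Fin m → U), (Set.univ : Set U).Definable L Z → Z ∈ D →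
      ∃ a ∈ Z, ∀ i, a i ∈ A := by
  constructor
  · intro hp Z hZ hZD
    obtain ⟨l, φ, c, hc, rfl⟩ := definable_iff_exists_params.1 hZ
    obtain ⟨a, ha, ha'⟩ := hp l φ c ((h _ _ _).2 hZD)
    exact ⟨a, ha', ha⟩
  · intro hD l φ b hb
    obtain ⟨a, ha', ha⟩ := hD _ (definable_realize_elim φ fun i => Set.mem_univ (b i))
      ((h _ _ _).1 hb)
    exact ⟨a, ha, ha'⟩

theorem isHeir_iff (h : Represents D p) :
    p.IsHeir A ↔ ∀ (l : ℕ) (R : Set (Fin m ⊕ Fin l → U)), A.Definable L R → ∀ b : Fin l → U,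
      {a | Sum.elim a b ∈ R} ∈ D → ∃ b' : Fin l → U, (∀ i, b' i ∈ A) ∧
        {a | Sum.elim a b' ∈ R} ∈ D := by
  have key : ∀ {l r : ℕ} (φ : L.Formula (Fin m ⊕ (Fin l ⊕ Fin r))) (a : Fin m → U)
      (b : Fin l → U) (c : Fin r → U), φ.Realize (Sum.elim a (Sum.elim b c)) ↔
      (φ.relabel (Equiv.sumAssoc _ _ _).symm).Realize (Sum.elim (Sum.elim a b) c) := by
    intro l r φ a b c
    rw [Formula.realize_relabel]
    have : Sum.elim (Sum.elim a b) c ∘ (Equiv.sumAssoc (Fin m) (Fin l) (Fin r)).symm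
        = Sum.elim a (Sum.elim b c) := by
      funext i
      rcases i with i | i | i <;> rfl
    rw [this]
  constructor
  · intro hp l R hR b hb
    obtain ⟨r, φ, c, hc, rfl⟩ := definable_iff_exists_params.1 hR
    have key' : ∀ (a : Fin m → U) (b : Fin l → U), φ.Realize (Sum.elim (Sum.elim a b) c) ↔
        (φ.relabel (Equiv.sumAssoc _ _ _)).Realize (Sum.elim a (Sum.elim b c)) := by
      intro a b
      rw [key, Formula.realize_relabel, Formula.realize_relabel, Function.comp_assoc]
      simp
    obtain ⟨b', hb', h'⟩ := hp l r (φ.relabel (Equiv.sumAssoc _ _ _)) c hc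
      ⟨b, (h _ _ _).2 (by simpa only [Set.mem_ofPred_eq, ← key'] using hb)⟩
    refine ⟨b', hb', ?_⟩
    have := (h _ _ _).1 h'
    simpa only [Set.mem_ofPred_eq, ← key'] using this
  · rintro hD l r φ c hc ⟨b, hb⟩
    have hb := (h _ _ _).1 hb
    simp only [key] at hb
    obtain ⟨b', hb', h'⟩ := hD l _ (definable_realize_elim
      (φ.relabel (Equiv.sumAssoc (Fin m) (Fin l) (Fin r)).symm) hc) b hb
    refine ⟨b', hb', (h _ _ _).2 ?_⟩
    simp only [key]
    exact h'

theorem isInvariant_iff (h : Represents D p) : p.IsInvariant A ↔ UInvariant L D A := by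
  constructor
  · intro hp β _ R hR b b' hbb
    obtain ⟨l, φ, c, hc, rfl⟩ := definable_iff_exists_params.1 hR
    obtain ⟨n, ⟨e⟩⟩ := Finite.exists_equiv_fin (β ⊕ Fin l)
    let ψ : L.Formula (Fin m ⊕ Fin n) :=
      φ.relabel (Sum.elim (Sum.elim Sum.inl fun i => Sum.inr (e (Sum.inl i)))
        fun i => Sum.inr (e (Sum.inr i)))
    have key : ∀ (a : Fin m → U) (d : β → U), φ.Realize (Sum.elim (Sum.elim a d) c) ↔
        ψ.Realize (Sum.elim a (Sum.elim d c ∘ e.symm)) := by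
      intro a d
      rw [Formula.realize_relabel]
      refine iff_of_eq (congrArg _ ?_)
      funext i
      rcases i with (i | i) | i <;> simp
    -- Adjoining the parameters c from A to both tuples does not affect equality of types over A.
    have hs : SameTypeOver L A (Sum.elim b c ∘ e.symm) (Sum.elim b' c ∘ e.symm) := by
      rw [sameTypeOver_iff]
      refine SameType.comp ?_ _
      intro Z hZ
      exact hbb _ (definable_slice hZ subset_rfl hc)
    have := hp n ψ _ _ hs
    rw [h, h] at this
    simpa only [Set.mem_ofPred_eq, key] using this
  · intro hD n φ b b' hbb
    rw [h, h]
    exact hD (Fin n) _ (definable_realize A φ) b b' (sameTypeOver_iff.1 hbb)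

end Represents

end Translation

section Small

variable {U : Type w} {κ : Cardinal.{w}}

theorem mk_union_lt {A B : Set U} (hκ : ℵ₀ ≤ κ) (hA : #A < κ) (hB : #B < κ) : #↥(A ∪ B) < κ :=
  (Cardinal.mk_union_le _ _).trans_lt (Cardinal.add_lt_of_lt hκ hA hB)

theorem mk_lt_of_finite {B : Set U} (hκ : ℵ₀ ≤ κ) (hB : B.Finite) : #B < κ :=
  (Cardinal.mk_lt_aleph0_iff.2 hB).trans_le hκ

end Small

/-! ### Saturation for countable tuples of variables -/

section Saturation

theorem exists_ultrafilter_of_inter {X : Type*} (S : Set (Set X)) (hne : S.Nonempty)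
    (hinter : ∀ s ∈ S, ∀ t ∈ S, s ∩ t ∈ S) (hS : ∀ s ∈ S, s.Nonempty) :
    ∃ D : Ultrafilter X, ∀ s ∈ S, s ∈ D := by
  let B : FilterBasis X := ⟨S, hne, fun {x y} hx hy => ⟨x ∩ y, hinter x hx y hy, subset_rfl⟩⟩
  have hB : B.filter.NeBot := B.hasBasis.neBot_iff.2 fun {s} hs => hS s hs
  exact ⟨Ultrafilter.of B.filter, fun s hs => Ultrafilter.of_le _ (B.mem_filter_of_mem hs)⟩

variable {L : FirstOrder.Language.{u, v}} {U : Type w} [L.Structure U]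

theorem exists_finset_of_definable {α : Type} {A : Set U} {s : Set (α → U)}
    (hs : A.Definable L s) :
    ∃ t : Finset α, ∀ v v' : α → U, (∀ i ∈ t, v i = v' i) → v ∈ s → v' ∈ s := by
  classical
  obtain ⟨φ, rfl⟩ := hs
  refine ⟨φ.freeVarFinset, fun v v' h hv => ?_⟩
  have key : ∀ x : α → U, φ.Realize x ↔
      (φ.restrictFreeVar (Set.inclusion subset_rfl)).Realize
        (x ∘ (Subtype.val : ↥(φ.freeVarFinset : Set α) → α)) default :=
    fun x => (BoundedFormula.realize_restrictFreeVar' subset_rfl).symm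
  have hv := (key v).1 hv
  refine (key v').2 ?_
  convert hv using 1
  funext i
  exact (h i i.2).symm

variable [Nonempty U] {κ : Cardinal.{w}}

theorem IsSaturated.exists_realizes_fin (hU : IsSaturated L U κ) {A : Set U} (hA : #A < κ) {n : ℕ}
    (D : Ultrafilter (Fin n → U)) : ∃ a, URealizes L D A a := by
  obtain ⟨p, hp⟩ := exists_type_of_ultrafilter L[[A]] U D
  obtain ⟨a, rfl⟩ := hU A hA n p
  refine ⟨a, ?_⟩
  rintro Z ⟨F, rfl⟩ hZ
  have := (hp F).2 hZ
  rwa [Theory.CompleteType.formula_mem_typeOf] at this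

theorem IsSaturated.exists_realizes_finite (hU : IsSaturated L U κ) {A : Set U} (hA : #A < κ)
    {α : Type} [Finite α] (D : Ultrafilter (α → U)) : ∃ a, URealizes L D A a := by
  obtain ⟨n, ⟨e⟩⟩ := Finite.exists_equiv_fin α
  obtain ⟨a, ha⟩ := hU.exists_realizes_fin hA (D.map fun v => v ∘ e.symm)
  refine ⟨a ∘ e, fun Z hZ hZD => ha _ (hZ.preimage_comp e) ?_⟩
  rw [Ultrafilter.mem_map]
  convert hZD using 1
  ext v
  simp [Function.comp_assoc]

/-- The projection of a D-large A-definable set is again A-definable and large, so it contains x.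
Hence the fibres over x are nonempty and closed under intersection, and saturation over A and x
supplies the next coordinate. -/
theorem IsSaturated.exists_extension (hU : IsSaturated L U κ) (hκ : ℵ₀ ≤ κ) {A : Set U}
    (hA : #A < κ) {n : ℕ} (D : Ultrafilter (Fin (n + 1) → U)) {x : Fin n → U}
    (hx : URealizes L (D.map fun v => v ∘ Fin.castSucc) A x) :
    ∃ y : U, URealizes L D A (Fin.snoc x y : Fin (n + 1) → U) := by
  let g : Fin (n + 1) → Fin 1 ⊕ Fin n := Fin.snoc (α := fun _ => Fin 1 ⊕ Fin n) Sum.inr (Sum.inl 0)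
  let slice : Set (Fin (n + 1) → U) → Set (Fin 1 → U) := fun Z => {y | Sum.elim y x ∘ g ∈ Z}
  have hg : ∀ y : Fin 1 → U, Sum.elim y x ∘ g = (Fin.snoc x (y 0) : Fin (n + 1) → U) := by
    intro y
    funext i
    refine Fin.lastCases ?_ (fun i => ?_) i <;> simp [g]
  obtain ⟨E, hE⟩ := exists_ultrafilter_of_inter
    (slice '' {Z | A.Definable L Z ∧ Z ∈ D})
    ⟨_, Set.univ, ⟨Set.definable_univ, Filter.univ_mem⟩, rfl⟩
    (by
      rintro _ ⟨Z, hZ, rfl⟩ _ ⟨Z', hZ', rfl⟩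
      exact ⟨Z ∩ Z', ⟨hZ.1.inter hZ'.1, Filter.inter_mem hZ.2 hZ'.2⟩, rfl⟩)
    (by
      rintro _ ⟨Z, ⟨hZ, hZD⟩, rfl⟩
      have := hx _ (hZ.image_comp Fin.castSucc)
        (Ultrafilter.mem_map.2 (Filter.mem_of_superset hZD fun v hv => ⟨v, hv, rfl⟩))
      obtain ⟨z, hz, hzx⟩ := this
      refine ⟨fun _ => z (Fin.last n), ?_⟩
      change _ ∘ g ∈ Z
      rw [hg, ← hzx]
      convert hz
      exact Fin.snoc_init_self z)
  have hfin : #(Set.range x) < κ := (Cardinal.mk_lt_aleph0_iff.2 inferInstance).trans_le hκ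
  obtain ⟨y, hy⟩ := hU.exists_realizes_fin (A := A ∪ Set.range x)
    (mk_union_lt hκ hA hfin) E
  refine ⟨y 0, fun Z hZ hZD => ?_⟩
  rw [← hg]
  exact hy (slice Z) (definable_slice (hZ.preimage_comp g) Set.subset_union_left
    fun i => Or.inr (Set.mem_range_self i)) (hE _ ⟨Z, ⟨hZ, hZD⟩, rfl⟩)

/-- Saturation speaks of finite tuples only; the sequence is built one coordinate at a time, and a
definable set depends on finitely many coordinates. -/
theorem IsSaturated.exists_realizes_nat (hU : IsSaturated L U κ) (hκ : ℵ₀ ≤ κ) {A : Set U}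
    (hA : #A < κ) (D : Ultrafilter (ℕ → U)) : ∃ a, URealizes L D A a := by
  let Q : ℕ → (ℕ → U) → Prop := fun n w =>
    URealizes L (D.map fun v (i : Fin n) => v i) A fun i : Fin n => w i
  have step : ∀ n (w : {w // Q n w}), ∃ w' : {w // Q (n + 1) w}, ∀ i < n, w'.1 i = w.1 i := by
    rintro n ⟨w, hw⟩
    obtain ⟨y, hy⟩ := hU.exists_extension hκ hA (D.map fun v (i : Fin (n + 1)) => v i)
      (x := fun i : Fin n => w i) (by rw [Ultrafilter.map_map]; exact hw)
    refine ⟨⟨fun i => if i < n then w i else y, ?_⟩, fun i hi => by simp [hi]⟩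
    convert hy using 1
    funext i
    refine Fin.lastCases ?_ (fun i => ?_) i <;> simp
  have h0 : ∀ w : ℕ → U, Q 0 w := by
    intro w Z hZ hZD
    obtain ⟨v, hv⟩ := Ultrafilter.nonempty_of_mem hZD
    rwa [Subsingleton.elim (fun i : Fin 0 => w i) v]
  choose F hF using step
  have w0 : {w // Q 0 w} := by
    let w : ℕ → U := fun _ => Classical.arbitrary U
    exact ⟨w, h0 w⟩
  let s : ∀ n, {w // Q n w} := fun n =>
    Nat.rec (motive := fun n => {w // Q n w}) w0 F n
  have hs : ∀ n, ∀ i < n, (s n).1 i = (s (i + 1)).1 i := by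
    intro n
    induction n with
    | zero => intro i hi; omega
    | succ n ih =>
      intro i hi
      rcases Nat.lt_succ_iff_lt_or_eq.1 hi with h | rfl
      · rw [← ih i h]
        exact hF n (s n) i h
      · rfl
  refine ⟨fun i => (s (i + 1)).1 i, fun Z hZ hZD => ?_⟩
  obtain ⟨t, ht⟩ := exists_finset_of_definable hZ
  obtain ⟨n, hn⟩ : ∃ n, ∀ i ∈ t, i < n :=
    ⟨t.sup id + 1, fun i hi => Nat.lt_succ_of_le (Finset.le_sup (f := id) hi)⟩
  -- The value 0 outside the range is harmless: membership in Z depends only on the coordinates in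
  -- t, which are all below n.
  let r : ℕ → Fin (n + 1) := fun i => if h : i < n + 1 then ⟨i, h⟩ else 0
  have hr : ∀ (v : ℕ → U) (i), i ∈ t → v (r i) = v i := by
    intro v i hi
    have : i < n + 1 := (hn i hi).trans (Nat.lt_succ_self n)
    simp only [r, dif_pos this]
  have h1 := (s (n + 1)).2 _ (hZ.preimage_comp r) (by
    rw [Ultrafilter.mem_map]
    refine Filter.mem_of_superset hZD fun v hv => ?_
    exact ht v _ (fun i hi => (hr v i hi).symm) hv)
  refine ht _ _ (fun i hi => ?_) h1
  have : i < n + 1 := (hn i hi).trans (Nat.lt_succ_self n)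
  rw [← hs (n + 1) i this]
  exact hr _ i hi

theorem IsSaturated.exists_realizes (hU : IsSaturated L U κ) (hκ : ℵ₀ ≤ κ) {A : Set U}
    (hA : #A < κ) {α : Type} [Countable α] (D : Ultrafilter (α → U)) :
    ∃ a, URealizes L D A a := by
  classical
  obtain ⟨f, hf⟩ := exists_injective_nat α
  have hext : ∀ v : α → U, (Function.extend f v fun _ => Classical.arbitrary U) ∘ f = v :=
    fun v => funext fun i => hf.extend_apply _ _ _
  obtain ⟨a, ha⟩ := hU.exists_realizes_nat hκ hA
    (D.map fun v => Function.extend f v fun _ => Classical.arbitrary U)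
  refine ⟨a ∘ f, fun Z hZ hZD => ha _ (hZ.preimage_comp f) ?_⟩
  rw [Ultrafilter.mem_map]
  refine Filter.mem_of_superset hZD fun v hv => ?_
  change _ ∘ f ∈ Z
  rwa [hext]

/-- A finitely satisfiable family of relations in countably many variables, definable over few
parameters, is satisfied in a saturated structure. -/
theorem IsSaturated.exists_mem (hU : IsSaturated L U κ) (hκ : ℵ₀ ≤ κ) {A : Set U}
    (hA : #A < κ) {α : Type} [Countable α] (S : Set (Set (α → U)))
    (hS : ∀ s ∈ S, A.Definable L s)
    (hfin : ∀ T : Finset (Set (α → U)), (T : Set (Set (α → U))) ⊆ S →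
      ∃ a, ∀ s ∈ T, a ∈ s) : ∃ a, ∀ s ∈ S, a ∈ s := by
  obtain ⟨D, hD⟩ := Ultrafilter.exists_ultrafilter_of_finite_inter_nonempty S fun T hT => by
    obtain ⟨a, ha⟩ := hfin T hT
    exact ⟨a, fun s hs => ha s hs⟩
  obtain ⟨a, ha⟩ := hU.exists_realizes hκ hA D
  exact ⟨a, fun s hs => ha s (hS s hs) (hD hs)⟩

end Saturation

/-! ### Combinatorics of combs and chains in the binary tree -/

section Combs

/-- The list `s :: l` of nodes is a comb if for some `σ`, the node `s` lies above `σ⌢0` and the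
nodes of the comb `l` lie above `σ⌢1`. -/
inductive CombList : List (List Bool) → Prop
  | nil : CombList []
  | single (s : List Bool) : CombList [s]
  | cons (σ s : List Bool) (l : List (List Bool)) (hs : σ ++ [false] <+: s)
      (hl : ∀ t ∈ l, σ ++ [true] <+: t) (h : CombList l) : CombList (s :: l)

/-- A list of nodes, each of which properly extends the previous ones. -/
def ChainList (l : List (List Bool)) : Prop := l.Pairwise fun σ τ => σ <+: τ ∧ σ ≠ τ

theorem not_prefix_of_prefix {σ t : List Bool} (h0 : σ ++ [false] <+: t) :
    ¬ σ ++ [true] <+: t := by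
  intro h1
  have := List.prefix_of_prefix_length_le h0 h1 (by simp)
  have := this.eq_of_length (by simp)
  simp at this

theorem exists_append_prefix {σ τ : List Bool} (h : σ <+: τ) (hne : σ ≠ τ) :
    ∃ i, σ ++ [i] <+: τ := by
  obtain ⟨r, rfl⟩ := h
  rcases r with _ | ⟨i, r⟩
  · simp at hne
  · exact ⟨i, r, by simp⟩

theorem CombList.rightComb {l : List (List Bool)} (h : CombList l) : RightComb {σ | σ ∈ l} := by
  induction h with
  | nil => exact RightComb.small _ (by simp)
  | single s => exact RightComb.small _ (by simp)
  | cons σ s l hs hl _ ih =>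
    refine RightComb.step _ σ ?_ ?_ ?_
    · intro t ht
      rcases List.mem_cons.1 ht with rfl | ht
      · refine ⟨(List.prefix_append _ _).trans hs, ?_⟩
        rintro rfl
        simpa using hs.length_le
      · refine ⟨(List.prefix_append _ _).trans (hl t ht), ?_⟩
        rintro rfl
        simpa using (hl _ ht).length_le
    · rw [Set.encard_eq_one]
      refine ⟨s, Set.eq_singleton_iff_unique_mem.2 ⟨⟨by simp, hs⟩, ?_⟩⟩
      rintro t ⟨ht, ht0⟩
      rcases List.mem_cons.1 ht with rfl | ht
      · rfl
      · exact absurd (hl t ht) (not_prefix_of_prefix ht0)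
    · convert ih using 1
      ext t
      constructor
      · rintro ⟨ht, ht1⟩
        rcases List.mem_cons.1 ht with rfl | ht
        · exact absurd ht1 (not_prefix_of_prefix hs)
        · exact ht
      · exact fun ht => ⟨List.mem_cons_of_mem _ ht, hl t ht⟩

/-- Consistency tests finite subsets only. The list may exceed s: at every branching it also takes
the unique node of X on the left. -/
theorem RightComb.exists_combList {X : Set (List Bool)} (h : RightComb X) :
    ∀ s : Finset (List Bool), (s : Set (List Bool)) ⊆ X →
      ∃ l, CombList l ∧ (∀ σ ∈ l, σ ∈ X) ∧ ∀ σ ∈ s, σ ∈ l := by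
  classical
  induction h with
  | small X hX =>
    intro s hs
    rcases s.eq_empty_or_nonempty with rfl | ⟨σ, hσ⟩
    · exact ⟨[], CombList.nil, by simp, by simp⟩
    · refine ⟨[σ], CombList.single σ, by simpa using hs hσ, fun τ hτ => ?_⟩
      simpa using Set.encard_le_one_iff.1 hX _ _ (hs hτ) (hs hσ)
  | step X σ hX h0 _ ih =>
    intro s hs
    obtain ⟨x, hx⟩ := Set.encard_eq_one.1 h0
    have hxX : x ∈ X ∩ cone (σ ++ [false]) := hx ▸ Set.mem_singleton x
    obtain ⟨l, hl, hlX, hsl⟩ := ih (s.filter fun τ => σ ++ [true] <+: τ) (by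
      intro τ hτ
      rw [Finset.mem_coe, Finset.mem_filter] at hτ
      exact ⟨hs hτ.1, hτ.2⟩)
    refine ⟨x :: l, CombList.cons σ x l hxX.2 (fun t ht => (hlX t ht).2) hl, ?_, ?_⟩
    · intro τ hτ
      rcases List.mem_cons.1 hτ with rfl | hτ
      · exact hxX.1
      · exact (hlX τ hτ).1
    · intro τ hτ
      have hτX := hX (hs hτ)
      obtain ⟨i, hi⟩ := exists_append_prefix hτX.1 (Ne.symm hτX.2)
      cases i with
      | false =>
        have : τ ∈ ({x} : Set (List Bool)) := hx ▸ ⟨hs hτ, hi⟩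
        rw [Set.mem_singleton_iff.1 this]
        exact List.mem_cons_self
      | true => exact List.mem_cons_of_mem _ (hsl τ (Finset.mem_filter.2 ⟨hτ, hi⟩))

theorem ChainList.exists_top {l : List (List Bool)} (h : ChainList l) : ∃ τ, ∀ σ ∈ l, σ <+: τ := by
  induction l with
  | nil => exact ⟨[], by simp⟩
  | cons σ l ih =>
    obtain ⟨h1, h2⟩ := List.pairwise_cons.1 h
    obtain ⟨τ, hτ⟩ := ih h2
    rcases l with _ | ⟨ρ, l⟩
    · exact ⟨σ, by simp⟩
    · refine ⟨τ, fun ρ' hρ' => ?_⟩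
      rcases List.mem_cons.1 hρ' with rfl | hρ'
      · exact (h1 ρ List.mem_cons_self).1.trans (hτ ρ List.mem_cons_self)
      · exact hτ ρ' hρ'

theorem length_initSeg (α : ℕ → Bool) (i : ℕ) : (initSeg α i).length = i := by simp [initSeg]

theorem initSeg_prefix (α : ℕ → Bool) {i j : ℕ} (h : i ≤ j) : initSeg α i <+: initSeg α j := by
  rw [List.prefix_iff_eq_take, length_initSeg]
  apply List.ext_getElem
  · simp [initSeg, h]
  · intro n h1 h2
    simp [initSeg]

theorem initSeg_of_prefix {σ τ : List Bool} (h : σ <+: τ) :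
    initSeg (fun i => τ.getD i false) σ.length = σ := by
  apply List.ext_getElem
  · simp [initSeg]
  · intro n h1 h2
    obtain ⟨r, rfl⟩ := h
    simp [initSeg, List.getElem?_append_left h2, h2]

/-- Maps between trees under which `g (σ⌢i)` extends `(g σ)⌢i`. -/
def IsTreeEmbedding (g : List Bool → List Bool) : Prop := ∀ σ i, g σ ++ [i] <+: g (σ ++ [i])

namespace IsTreeEmbedding

variable {g : List Bool → List Bool}

theorem isPrefix (hg : IsTreeEmbedding g) {σ τ : List Bool} {i : Bool} (h : σ ++ [i] <+: τ) :
    g σ ++ [i] <+: g τ := by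
  obtain ⟨r, rfl⟩ := h
  induction r using List.reverseRecOn with
  | nil => simpa using hg σ i
  | append_singleton r j ih =>
    rw [← List.append_assoc]
    exact ih.trans ((List.prefix_append _ _).trans (hg _ j))

theorem combList (hg : IsTreeEmbedding g) {l : List (List Bool)} (h : CombList l) :
    CombList (l.map g) := by
  induction h with
  | nil => exact CombList.nil
  | single s => exact CombList.single _
  | cons σ s l hs hl _ ih =>
    refine CombList.cons (g σ) (g s) _ (hg.isPrefix hs) ?_ ih
    simpa using fun t ht => hg.isPrefix (hl t ht)

theorem chainList (hg : IsTreeEmbedding g) {l : List (List Bool)} (h : ChainList l) :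
    ChainList (l.map g) := by
  refine List.Pairwise.map g ?_ h
  rintro σ τ ⟨h1, h2⟩
  obtain ⟨i, hi⟩ := exists_append_prefix h1 h2
  have := hg.isPrefix hi
  refine ⟨(List.prefix_append _ _).trans this, fun h => ?_⟩
  simpa [h] using this.length_le

theorem cons (i : Bool) : IsTreeEmbedding (List.cons i) := fun σ j => by simp

theorem append (ρ : List Bool) : IsTreeEmbedding (ρ ++ ·) := fun σ j => by simp

end IsTreeEmbedding

/-- Every set of nodes contains a copy of the binary tree or misses a cone. -/
theorem exists_treeEmbedding_mem_or_append (P : List Bool → Prop) :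
    (∃ g, IsTreeEmbedding g ∧ ∀ σ, P (g σ)) ∨ ∃ ρ, ∀ σ, ¬ P (ρ ++ σ) := by
  by_cases h : ∃ ρ, ∀ σ, ¬ P (ρ ++ σ)
  · exact Or.inr h
  · push Not at h
    choose f hf using h
    -- Here P (ρ ++ f ρ) holds for every ρ. Recursion on lists peels off the head, whereas g (σ⌢i)
    -- must be built from g σ, so g' reads words backwards.
    let g' : List Bool → List Bool := fun l =>
      List.rec ([] ++ f []) (fun i _ r => (r ++ [i]) ++ f (r ++ [i])) l
    have hg' : ∀ l, P (g' l) := by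
      intro l
      cases l with
      | nil => exact hf _
      | cons i l => exact hf _
    refine Or.inl ⟨fun σ => g' σ.reverse, fun σ i => ?_, fun σ => hg' _⟩
    change g' σ.reverse ++ [i] <+: g' (σ ++ [i]).reverse
    rw [List.reverse_append]
    exact List.prefix_append _ _

end Combs

/-! ### Trees of tuples with consistent combs and inconsistent chains -/

section Trees

variable {L : FirstOrder.Language.{u, v}} {N : Type*} [L.Structure N] {n m : ℕ}

/-- The instances of `φ(x, y)` at the tuples in the list have a common solution. -/
def Solvable (φ : L.Formula (Fin n ⊕ Fin m)) (l : List (Fin m → N)) : Prop :=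
  ∃ a : Fin n → N, ∀ y ∈ l, φ.Realize (Sum.elim a y)

/-- A tree of tuples whose combs are consistent relative to `C` and whose chains of length `k`,
when lengthened by lists in `Q`, are inconsistent. -/
def IsCombTree (φ : L.Formula (Fin n ⊕ Fin m)) (k : ℕ) (C Q : Set (List (Fin m → N)))
    (b : List Bool → Fin m → N) : Prop :=
  (∀ c ∈ C, ∀ l, CombList l → Solvable φ (c ++ l.map b)) ∧
    ∀ c ∈ Q, ∀ l, ChainList l → c.length + l.length = k → ¬ Solvable φ (c ++ l.map b)

variable {φ : L.Formula (Fin n ⊕ Fin m)} {k : ℕ} {C Q : Set (List (Fin m → N))}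
  {b : List Bool → Fin m → N}

theorem IsCombTree.comp (h : IsCombTree φ k C Q b) {g : List Bool → List Bool}
    (hg : IsTreeEmbedding g) : IsCombTree φ k C Q (b ∘ g) := by
  refine ⟨fun c hc l hl => ?_, fun c hc l hl hk => ?_⟩
  · have := h.1 c hc _ (hg.combList hl)
    rwa [List.map_map] at this
  · have := h.2 c hc _ (hg.chainList hl) (by simpa using hk)
    rwa [List.map_map] at this

theorem IsCombTree.mono (h : IsCombTree φ k C Q b) {C' Q' : Set (List (Fin m → N))}
    (hC : C' ⊆ C) (hQ : Q' ⊆ Q) : IsCombTree φ k C' Q' b :=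
  ⟨fun c hc => h.1 c (hC hc), fun c hc => h.2 c (hQ hc)⟩

/-- Passing to a copy of the binary tree or to a cone preserves combs and chains. This is why the
sets containing no tree are closed under finite unions. -/
theorem IsCombTree.exists_sub_or (h : IsCombTree φ k C Q b) {Z Z' : Set (Fin m → N)}
    (hZ : ∀ σ, b σ ∈ Z ∪ Z') : ∃ g, IsCombTree φ k C Q (b ∘ g) ∧
      ((∀ σ, b (g σ) ∈ Z) ∨ ∀ σ, b (g σ) ∈ Z') := by
  rcases exists_treeEmbedding_mem_or_append (fun σ => b σ ∈ Z) with ⟨g, hg, hgZ⟩ | ⟨ρ, hρ⟩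
  · exact ⟨g, h.comp hg, Or.inl hgZ⟩
  · exact ⟨_, h.comp (IsTreeEmbedding.append ρ), Or.inr fun σ => (hZ _).resolve_left (hρ σ)⟩

/-- The part of a tree above its right successor of the root remains a tree relative to the
root and to the nodes above the left successor. -/
theorem IsCombTree.right (h : IsCombTree φ k C Q b) :
    IsCombTree φ k (C ∪ {d | ∃ c ∈ C, ∃ σ, d = c ++ [b (false :: σ)]})
      (Q ∪ {d | ∃ c ∈ Q, d = c ++ [b [] ]}) (b ∘ List.cons true) := by
  have h' := h.comp (IsTreeEmbedding.cons true)
  constructor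
  · rintro d (hd | ⟨c, hc, σ, rfl⟩) l hl
    · exact h'.1 d hd l hl
    -- A node on the left followed by a comb on the right is a comb branching at the root.
    · have := h.1 c hc ((false :: σ) :: l.map (List.cons true))
        (CombList.cons [] _ _ (by simp) (by simp) ((IsTreeEmbedding.cons true).combList hl))
      simpa using this
  · rintro d (hd | ⟨c, hc, rfl⟩) l hl hk
    · exact h'.2 d hd l hl hk
    · have := h.2 c hc ([] :: l.map (List.cons true))
        (List.pairwise_cons.2 ⟨by simp, (IsTreeEmbedding.cons true).chainList hl⟩)
        (by simp at hk ⊢; omega)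
      simpa using this

theorem solvable_iff_hasSolution {ι : Type*} (b : ι → Fin m → N) {l : List ι} {s : Finset ι}
    (h : ∀ i, i ∈ l ↔ i ∈ s) : Solvable φ (l.map b) ↔ HasSolution φ b s := by
  simp [Solvable, HasSolution, h]

theorem isCTPWitness_iff : IsCTPWitness k φ b ↔ IsCombTree φ k {[]} {[]} b := by
  classical
  constructor
  · rintro ⟨h1, h2⟩
    refine ⟨?_, ?_⟩
    · rintro _ rfl l hl
      exact (solvable_iff_hasSolution (s := l.toFinset) b (by simp)).2
        (h2 _ hl.rightComb _ (by intro; simp))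
    · rintro _ rfl l hl hk hsol
      obtain ⟨τ, hτ⟩ := hl.exists_top
      -- Nodes of a chain lie on distinct levels, so k nodes give k distinct indices along one
      -- branch.
      have hnd : (l.map List.length).Nodup := by
        refine List.Pairwise.map _ ?_ hl
        rintro σ σ' ⟨h, hne⟩ heq
        exact hne (h.eq_of_length heq)
      refine h1 (fun i => τ.getD i false) (l.map List.length).toFinset (Set.subset_univ _) ?_ ?_
      · rw [List.toFinset_card_of_nodup hnd]
        simpa using hk
      · obtain ⟨a, ha⟩ := hsol
        refine ⟨a, fun i hi => ?_⟩
        obtain ⟨σ, hσ, rfl⟩ := List.mem_map.1 (List.mem_toFinset.1 hi)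
        simp only [initSeg_of_prefix (hτ σ hσ)]
        exact ha _ (by simpa using ⟨σ, hσ, rfl⟩)
  · rintro ⟨h1, h2⟩
    refine ⟨fun α s _ hk hsol => ?_, fun X hX s hs => ?_⟩
    · refine h2 [] rfl ((s.sort (· ≤ ·)).map (initSeg α)) ?_ (by simpa using hk) ?_
      · refine List.Pairwise.map _ ?_ (Finset.sortedLT_sort s).pairwise
        intro i j hij
        refine ⟨initSeg_prefix α hij.le, fun h => hij.ne ?_⟩
        simpa [length_initSeg] using congrArg List.length h
      · obtain ⟨a, ha⟩ := hsol
        refine ⟨a, ?_⟩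
        simpa using ha
    · obtain ⟨l, hl, -, hsl⟩ := hX.exists_combList s hs
      obtain ⟨a, ha⟩ := h1 [] rfl l hl
      exact ⟨a, fun σ hσ => ha _ (by simpa using ⟨σ, hsl σ hσ, rfl⟩)⟩

end Trees

/-! ### Definability of solvability -/

section Solvability

variable {L : FirstOrder.Language.{u, v}} {n m : ℕ}

/-- The formula saying that the instances of `φ(x, y)` at the listed tuples of variables have a
common solution. -/
noncomputable def solvableFormula {ι : Type} (φ : L.Formula (Fin n ⊕ Fin m)) (l : List ι) :
    L.Formula (ι × Fin m) :=
  Formula.iExs (Fin n) ((l.map fun i => φ.relabel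
    (Sum.elim Sum.inr fun j => Sum.inl (i, j) : Fin n ⊕ Fin m → (ι × Fin m) ⊕ Fin n)).foldr
      (· ⊓ ·) ⊤)

theorem realize_solvableFormula {N : Type*} [L.Structure N] {ι : Type}
    {φ : L.Formula (Fin n ⊕ Fin m)} {l : List ι} {v : ι × Fin m → N} :
    (solvableFormula φ l).Realize v ↔ Solvable φ (l.map fun i j => v (i, j)) := by
  rw [solvableFormula, Formula.realize_iExs]
  refine exists_congr fun a => ?_
  rw [Formula.Realize, BoundedFormula.realize_foldr_inf]
  simp only [List.mem_map, forall_exists_index, and_imp, forall_apply_eq_imp_iff₂]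
  refine forall₂_congr fun i _ => ?_
  refine Formula.realize_relabel.trans (iff_of_eq (congrArg _ ?_))
  funext j
  rcases j with j | j <;> rfl

theorem definable_solvable {U : Type w} [L.Structure U] {α : Type} {A : Set U}
    (φ : L.Formula (Fin n ⊕ Fin m)) (l : List ((α → U) → Fin m → U))
    (hl : ∀ e ∈ l, ∃ g : Fin m → α ⊕ A, ∀ v i, e v i = Sum.elim v (fun x : A => (x : U)) (g i)) :
    A.Definable L {v : α → U | Solvable φ (l.map fun e => e v)} := by
  choose g hg using fun i : Fin l.length => hl l[i] (List.getElem_mem _)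
  have := definable_subst (definable_realize A (solvableFormula φ (List.finRange l.length)))
    fun x : Fin l.length × Fin m => g x.1 x.2
  convert this using 1
  ext v
  simp only [Set.mem_ofPred_eq, realize_solvableFormula]
  refine iff_of_eq (congrArg _ ?_)
  apply List.ext_getElem
  · simp
  · intro i h1 h2
    funext j
    have h2' : i < l.length := by simpa using h2
    simpa using hg ⟨i, h2'⟩ v j

theorem definable_solvable_tree {U : Type w} [L.Structure U] {A : Set U}
    (φ : L.Formula (Fin n ⊕ Fin m)) {c : List (Fin m → U)} (hc : ∀ y ∈ c, ∀ i, y i ∈ A)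
    (l : List (List Bool)) :
    A.Definable L {v : List Bool × Fin m → U |
      Solvable φ (c ++ l.map fun σ i => v (σ, i))} := by
  have := definable_solvable (A := A) φ
    (c.map (fun y _ => y) ++ l.map fun σ (v : List Bool × Fin m → U) i => v (σ, i)) (by
      intro e he
      rcases List.mem_append.1 he with h | h
      · obtain ⟨y, hy, rfl⟩ := List.mem_map.1 h
        exact ⟨fun i => Sum.inr ⟨y i, hc y hy i⟩, fun _ _ => rfl⟩
      · obtain ⟨σ, -, rfl⟩ := List.mem_map.1 h
        exact ⟨fun i => Sum.inl (σ, i), fun _ _ => rfl⟩)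
  simpa [Function.comp_def] using this

theorem definable_solvable_insert {U : Type w} [L.Structure U] {A : Set U}
    (φ : L.Formula (Fin n ⊕ Fin m)) {c l : List (Fin m → U)} (hc : ∀ y ∈ c, ∀ i, y i ∈ A)
    (hl : ∀ y ∈ l, ∀ i, y i ∈ A) :
    A.Definable L {y : Fin m → U | Solvable φ (c ++ y :: l)} := by
  have := definable_solvable (A := A) φ
    (c.map (fun y (_ : Fin m → U) => y) ++ (fun y => y) :: l.map fun y _ => y) (by
      intro e he
      rcases List.mem_append.1 he with h | h
      · obtain ⟨y, hy, rfl⟩ := List.mem_map.1 h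
        exact ⟨fun i => Sum.inr ⟨y i, hc y hy i⟩, fun _ _ => rfl⟩
      rcases List.mem_cons.1 h with rfl | h
      · exact ⟨fun i => Sum.inl i, fun _ _ => rfl⟩
      · obtain ⟨y, hy, rfl⟩ := List.mem_map.1 h
        exact ⟨fun i => Sum.inr ⟨y i, hl y hy i⟩, fun _ _ => rfl⟩)
  simpa [Function.comp_def] using this

theorem isCombTree_nil_iff {N : Type*} [L.Structure N] {φ : L.Formula (Fin n ⊕ Fin m)} {k : ℕ}
    {v : List Bool × Fin m → N} :
    IsCombTree φ k {[]} {[]} (fun σ i => v (σ, i)) ↔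
      (∀ l, CombList l → (solvableFormula φ l).Realize v) ∧
        ∀ l, ChainList l → l.length = k → ¬ (solvableFormula φ l).Realize v := by
  simp [IsCombTree, realize_solvableFormula]

end Solvability

/-! ### Moving trees between models of the theory -/

section Transfer

variable {L : FirstOrder.Language.{u, v}} {T : L.Theory} {n m k : ℕ}

/-- The index type may be infinite, so the existential closure is formed over the finitely many free
variables of F and the other entries are arbitrary. -/
theorem exists_realize_of_isComplete (hT : T.IsComplete) {N U : Type*} [L.Structure N]
    [L.Structure U] [Nonempty N] [Nonempty U] [N ⊨ T] [U ⊨ T] {α : Type} (F : L.Formula α)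
    {b : α → N} (hb : F.Realize b) : ∃ a : α → U, F.Realize a := by
  classical
  let F' : L.Formula ↥(F.freeVarFinset : Set α) := F.restrictFreeVar (Set.inclusion subset_rfl)
  have h1 : N ⊨ ((F'.relabel Sum.inr : L.Formula (Empty ⊕ _)).iExs _) := by
    refine Formula.realize_iExs.2 ⟨fun i => b i, ?_⟩
    rw [Formula.realize_relabel]
    exact (BoundedFormula.realize_restrictFreeVar' subset_rfl).2 hb
  have h2 : U ⊨ ((F'.relabel Sum.inr : L.Formula (Empty ⊕ _)).iExs _) :=
    (hT.realize_sentence_iff _ U).2 ((hT.realize_sentence_iff _ N).1 h1)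
  obtain ⟨a, ha⟩ := Formula.realize_iExs.1 h2
  rw [Formula.realize_relabel] at ha
  refine ⟨fun i => if h : i ∈ F.freeVarFinset then a ⟨i, h⟩ else Classical.arbitrary U, ?_⟩
  refine (BoundedFormula.realize_restrictFreeVar' (s := (F.freeVarFinset : Set α))
    subset_rfl).1 ?_
  change F'.Realize _
  convert ha using 2
  funext i
  exact dif_pos i.2

theorem exists_sameFormulas_of_isComplete {U : Type w} [L.Structure U] [Nonempty U] [U ⊨ T]
    {κ : Cardinal.{w}} (hT : T.IsComplete) (hU : IsSaturated L U κ) (hκ : ℵ₀ ≤ κ) {N : Type*}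
    [L.Structure N] [Nonempty N] [N ⊨ T] {α : Type} [Countable α] (b : α → N) :
    ∃ a : α → U, ∀ F : L.Formula α, F.Realize a ↔ F.Realize b := by
  obtain ⟨a, ha⟩ := hU.exists_mem hκ (A := ∅) (by simpa using Cardinal.aleph0_pos.trans_le hκ)
    {s : Set (α → U) | ∃ F : L.Formula α, F.Realize b ∧ s = {a | F.Realize a}}
    (by rintro _ ⟨F, -, rfl⟩; exact definable_realize _ F)
    (by
      classical
      intro S hS
      have : ∃ G : L.Formula α, G.Realize b ∧ ∀ a : α → U, G.Realize a → ∀ s ∈ S, a ∈ s := by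
        induction S using Finset.induction_on with
        | empty => exact ⟨⊤, by simp, by simp⟩
        | insert s S _ ih =>
          obtain ⟨G, hG, hGS⟩ := ih ((by simp : (S : Set (Set (α → U))) ⊆ _).trans hS)
          obtain ⟨F, hF, rfl⟩ := hS (Finset.mem_coe.2 (Finset.mem_insert_self s S))
          refine ⟨F ⊓ G, Formula.realize_inf.2 ⟨hF, hG⟩, fun a ha s hs => ?_⟩
          rcases Finset.mem_insert.1 hs with rfl | hs
          · exact (Formula.realize_inf.1 ha).1
          · exact hGS a (Formula.realize_inf.1 ha).2 s hs
      obtain ⟨G, hG, hGS⟩ := this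
      obtain ⟨a, ha⟩ := exists_realize_of_isComplete hT (U := U) G hG
      exact ⟨a, hGS a ha⟩)
  refine ⟨a, fun F => ⟨fun h => ?_, fun h => ha _ ⟨F, h, rfl⟩⟩⟩
  by_contra hn
  exact ha _ ⟨F.not, hn, rfl⟩ h

theorem HasKCTP.exists_isCombTree {U : Type w} [L.Structure U] [Nonempty U] [U ⊨ T]
    {κ : Cardinal.{w}} (hT : T.IsComplete) (hU : IsSaturated L U κ) (hκ : ℵ₀ ≤ κ)
    (h : HasKCTP T k) : ∃ (n m : ℕ) (φ : L.Formula (Fin n ⊕ Fin m))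
      (b : List Bool → Fin m → U), IsCombTree φ k {[]} {[]} b := by
  obtain ⟨N, n, m, φ, b, hb⟩ := h
  obtain ⟨a, ha⟩ := exists_sameFormulas_of_isComplete hT hU hκ
    fun x : List Bool × Fin m => b x.1 x.2
  refine ⟨n, m, φ, fun σ i => a (σ, i), isCombTree_nil_iff.2 ?_⟩
  simp only [ha]
  exact isCombTree_nil_iff.1 (isCTPWitness_iff.1 hb)

/-- The definition of k-CTP asks for a model in a fixed universe, which need not be that of U; the
type of the whole tree is realized in such a model. -/
theorem hasKCTP_of_isCombTree {U : Type w} [L.Structure U] [Nonempty U] [U ⊨ T]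
    {φ : L.Formula (Fin n ⊕ Fin m)} {b : List Bool → Fin m → U}
    (h : IsCombTree φ k {[]} {[]} b) : HasKCTP T k := by
  obtain ⟨N, a, ha⟩ := Theory.exists_modelType_is_realized_in T
    (T.typeOf fun x : List Bool × Fin m => b x.1 x.2)
  have key : ∀ F : L.Formula (List Bool × Fin m),
      F.Realize a ↔ F.Realize fun x : List Bool × Fin m => b x.1 x.2 := by
    intro F
    rw [← Theory.CompleteType.formula_mem_typeOf (T := T), ha,
      Theory.CompleteType.formula_mem_typeOf]
  refine ⟨N, n, m, φ, fun σ i => a (σ, i), isCTPWitness_iff.2 (isCombTree_nil_iff.2 ?_)⟩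
  simp only [key]
  exact isCombTree_nil_iff.1 h

end Transfer

theorem exists_seq_of_list {Y : Type*} (f : List Y → Y) :
    ∃ w : ℕ → Y, ∀ n, w n = f ((List.range n).map w) := by
  let l : ℕ → List Y := fun n => Nat.rec [] (fun _ l => l ++ [f l]) n
  have hl : ∀ n, (List.range n).map (fun i => f (l i)) = l n := by
    intro n
    induction n with
    | zero => rfl
    | succ n ih => rw [List.range_succ, List.map_append, ih]; rfl
  exact ⟨fun n => f (l n), fun n => by rw [hl]⟩

/-! ### Finite Morley sequences -/

section MorleyLists

variable (L : FirstOrder.Language.{u, v}) {U : Type w} [L.Structure U] {m : ℕ}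

/-- The set of entries of the tuples in a list. -/
def listParams (l : List (Fin m → U)) : Set U := {x | ∃ y ∈ l, ∃ i, y i = x}

/-- A finite Morley sequence over `A`, listed with its latest member first. -/
def MorleyList (D : Ultrafilter (Fin m → U)) (A : Set U) : List (Fin m → U) → Prop
  | [] => True
  | a :: l => URealizes L D (A ∪ listParams l) a ∧ MorleyList D A l

variable {L}

theorem finite_listParams (l : List (Fin m → U)) : (listParams l).Finite := by
  have : listParams l = ⋃ y ∈ {y | y ∈ l}, Set.range y := by
    ext x; simp [listParams]
  rw [this]
  exact (List.finite_toSet l).biUnion fun y _ => Set.finite_range y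

/-- The concatenation of a list of `N` tuples. -/
def listTuple (N : ℕ) (d : Fin m → U) (l : List (Fin m → U)) : Fin N × Fin m → U :=
  fun x => l.getD x.1 d x.2

theorem range_listTuple_subset {d : Fin m → U} (l : List (Fin m → U)) :
    Set.range (listTuple l.length d l) ⊆ listParams l := by
  rintro _ ⟨⟨i, j⟩, rfl⟩
  refine ⟨l[i], List.getElem_mem _, j, ?_⟩
  simp [listTuple]

/-- By induction the tails have the same type over A, and invariance passes this to the heads. The
tuple d is only a default entry, never reached because the lengths agree. -/
theorem MorleyList.sameType {D : Ultrafilter (Fin m → U)} {A : Set U} (hD : UInvariant L D A)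
    (d : Fin m → U) {l l' : List (Fin m → U)} (h : MorleyList L D A l) (h' : MorleyList L D A l')
    (hl : l.length = l'.length) :
    SameType L A (listTuple l.length d l) (listTuple l.length d l') := by
  induction l generalizing l' with
  | nil =>
    rw [List.eq_nil_of_length_eq_zero hl.symm]
    exact fun _ _ => Iff.rfl
  | cons a l ih =>
    rcases l' with _ | ⟨a', l'⟩
    · simp at hl
    have hl : l.length = l'.length := by simpa using hl
    have h2 := ih h.2 h'.2 hl
    let f : Fin (l.length + 1) × Fin m → Fin m ⊕ Fin l.length × Fin m := fun x =>
      Fin.cases (motive := fun _ => Fin m ⊕ Fin l.length × Fin m)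
        (Sum.inl x.2) (fun j => Sum.inr (j, x.2)) x.1
    have key : ∀ (a : Fin m → U) (t : List (Fin m → U)),
        listTuple (l.length + 1) d (a :: t) = Sum.elim a (listTuple l.length d t) ∘ f := by
      intro a t
      funext x
      obtain ⟨i, j⟩ := x
      refine Fin.cases ?_ (fun i => ?_) i <;> simp [listTuple, f]
    change SameType L A (listTuple (l.length + 1) d (a :: l)) (listTuple (l.length + 1) d (a' :: l'))
    rw [key, key]
    refine (hD.sameType_elim (h.1.mono ?_) (h'.1.mono ?_) h2).comp f
    · exact Set.union_subset_union_right _ (range_listTuple_subset l)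
    · rw [hl]
      exact Set.union_subset_union_right _ (range_listTuple_subset l')

theorem MorleyList.solvable_iff {D : Ultrafilter (Fin m → U)} {A : Set U} {n : ℕ}
    (hD : UInvariant L D A) {φ : L.Formula (Fin n ⊕ Fin m)} {l l' : List (Fin m → U)}
    (h : MorleyList L D A l) (h' : MorleyList L D A l') (hl : l.length = l'.length) :
    Solvable φ l ↔ Solvable φ l' := by
  rcases l with _ | ⟨d, t⟩
  · rw [List.eq_nil_of_length_eq_zero hl.symm]
  generalize hs : d :: t = s at *
  have key : ∀ r : List (Fin m → U), s.length = r.length → (Solvable φ r ↔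
      (solvableFormula φ (List.finRange s.length)).Realize (listTuple s.length d r)) := by
    intro r hr
    rw [realize_solvableFormula]
    refine iff_of_eq (congrArg _ ?_)
    apply List.ext_getElem
    · simp [hr]
    · intro i h1 h2
      funext j
      rw [List.getElem_map]
      simp [listTuple, h1]
  rw [key s rfl, key l' hl]
  exact h.sameType hD d h' hl _ (definable_realize A _)

theorem isMorley_iff {D : Ultrafilter (Fin m → U)} {p : GlobalType L U m} (hp : Represents D p)
    {A : Set U} {e : ℕ → Fin m → U} :
    p.IsMorley A e ↔ ∀ i, URealizes L D (A ∪ ⋃ j < i, Set.range (e j)) (e i) :=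
  forall_congr' fun _ => hp.realizes_iff

theorem MorleyList.of_seq {D : Ultrafilter (Fin m → U)} {A : Set U} {e : ℕ → Fin m → U}
    (he : ∀ i, URealizes L D (A ∪ ⋃ j < i, Set.range (e j)) (e i)) (N : ℕ) :
    MorleyList L D A ((List.range N).reverse.map e) := by
  induction N with
  | zero => exact trivial
  | succ N ih =>
    rw [List.range_succ, List.reverse_append, List.reverse_singleton, List.singleton_append,
      List.map_cons]
    refine ⟨(he N).mono (Set.union_subset_union_right _ ?_), ih⟩
    rintro x ⟨y, hy, i, rfl⟩
    simp only [List.mem_map, List.mem_reverse, List.mem_range] at hy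
    obtain ⟨j, hj, rfl⟩ := hy
    exact Set.mem_biUnion hj (Set.mem_range_self i)

theorem IsSaturated.exists_morley [Nonempty U] {κ : Cardinal.{w}} (hU : IsSaturated L U κ)
    (hκ : ℵ₀ ≤ κ) {A : Set U} (hA : #A < κ) (D : Ultrafilter (Fin m → U)) :
    ∃ e : ℕ → Fin m → U, ∀ i, URealizes L D (A ∪ ⋃ j < i, Set.range (e j)) (e i) := by
  have : ∀ l : List (Fin m → U), ∃ a, URealizes L D (A ∪ listParams l) a := fun l =>
    hU.exists_realizes_fin (mk_union_lt hκ hA (mk_lt_of_finite hκ (finite_listParams l))) D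
  choose f hf using this
  obtain ⟨e, he⟩ := exists_seq_of_list f
  refine ⟨e, fun i => ?_⟩
  have := hf ((List.range i).map e)
  rw [← he] at this
  refine this.mono (Set.union_subset_union_right _ ?_)
  intro x hx
  simp only [Set.mem_iUnion] at hx
  obtain ⟨j, hj, k, rfl⟩ := hx
  exact ⟨e j, List.mem_map.2 ⟨j, List.mem_range.2 hj, rfl⟩, k, rfl⟩

variable {n : ℕ} {φ : L.Formula (Fin n ⊕ Fin m)}

theorem exists_not_solvable_of_not_consistent {e : ℕ → Fin m → U}
    (h : ¬ Consistent φ e Set.univ) : ∃ N, ¬ Solvable φ ((List.range N).reverse.map e) := by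
  simp only [Consistent, Set.subset_univ, forall_true_left, not_forall] at h
  obtain ⟨s, hs⟩ := h
  refine ⟨s.sup id + 1, fun ⟨a, ha⟩ => hs ⟨a, fun i hi => ha _ ?_⟩⟩
  simp only [List.mem_map, List.mem_reverse, List.mem_range]
  exact ⟨i, Nat.lt_succ_of_le (Finset.le_sup (f := id) hi), rfl⟩

theorem not_consistent_of_not_solvable {e : ℕ → Fin m → U} {N : ℕ}
    (h : ¬ Solvable φ ((List.range N).reverse.map e)) : ¬ Consistent φ e Set.univ := by
  intro hc
  obtain ⟨a, ha⟩ := hc (Finset.range N) (Set.subset_univ _)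
  refine h ⟨a, fun y hy => ?_⟩
  simp only [List.mem_map, List.mem_reverse, List.mem_range] at hy
  obtain ⟨j, hj, rfl⟩ := hy
  exact ha j (Finset.mem_range.2 hj)

end MorleyLists

/-! ### Bi-invariance for ultrafilters -/

section BiInvariance

variable (L : FirstOrder.Language.{u, v}) {U : Type w} [L.Structure U] {m : ℕ}

/-- The global type of the ultrafilter `D` is bi-invariant over `A`. -/
def UBiInvariant (D : Ultrafilter (Fin m → U)) (A : Set U) : Prop :=
  UInvariant L D A ∧ ∀ (β : Type) [Finite β] (a : Fin m → U) (b : β → U),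
    URealizes L D (A ∪ Set.range b) a →
      ∃ r : Ultrafilter (β → U), UInvariant L r A ∧ URealizes L r (A ∪ Set.range a) b

variable {L}

theorem UInvariant.map {α α' : Type} {D : Ultrafilter (α → U)} {A : Set U}
    (hD : UInvariant L D A) (e : α' → α) : UInvariant L (D.map fun v => v ∘ e) A := by
  intro β _ R hR b b' hb
  have := hD β _ (hR.preimage_comp (Sum.map e id)) b b' hb
  simp only [Set.mem_preimage, Sum.elim_comp_map, Function.comp_id] at this
  exact this

theorem URealizes.map {α α' : Type} {D : Ultrafilter (α → U)} {A : Set U} {a : α → U}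
    (h : URealizes L D A a) (e : α' → α) : URealizes L (D.map fun v => v ∘ e) A (a ∘ e) :=
  fun _ hZ hZD => h _ (hZ.preimage_comp e) hZD

theorem Represents.uBiInvariant [Nonempty U] {D : Ultrafilter (Fin m → U)} {p : GlobalType L U m}
    (h : Represents D p) {A : Set U} (hp : p.IsBiInvariant A) : UBiInvariant L D A := by
  refine ⟨h.isInvariant_iff.1 hp.1, fun β _ a b hab => ?_⟩
  obtain ⟨n, ⟨e⟩⟩ := Finite.exists_equiv_fin β
  obtain ⟨r, hr, hr'⟩ := hp.2 n a (b ∘ e.symm) (h.realizes_iff.2 (by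
    rwa [e.symm.surjective.range_comp]))
  obtain ⟨F, hF⟩ := exists_ultrafilter_represents r
  refine ⟨F.map fun v => v ∘ e, (hF.isInvariant_iff.1 hr).map e, ?_⟩
  have := (hF.realizes_iff.1 hr').map e
  rwa [Function.comp_assoc, Equiv.symm_comp_self, Function.comp_id] at this

end BiInvariance

/-! ### Trees of finite height from a bi-invariant type -/

section GoodTrees

variable (L : FirstOrder.Language.{u, v}) {U : Type w} [L.Structure U] {m : ℕ}

instance finite_nodes (h : ℕ) : Finite {σ : List Bool // σ.length < h} :=
  (List.finite_length_lt Bool h).to_subtype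

/-- The entries of the tuples on the levels of a tree below `h`. -/
def treeTuple (h : ℕ) (b : List Bool → Fin m → U) : {σ : List Bool // σ.length < h} × Fin m → U :=
  fun x => b x.1 x.2

/-- Up to height `h`, every node of the tree realizes `E` over the nodes above it, and every node
above the left successor of a node realizes `D` over the nodes above the right successor. -/
def GoodTree (D E : Ultrafilter (Fin m → U)) (A : Set U) : ℕ → (List Bool → Fin m → U) → Prop
  | 0, _ => True
  | h + 1, b =>
    URealizes L E (A ∪ Set.range (Sum.elim (treeTuple h (b ∘ List.cons false))
      (treeTuple h (b ∘ List.cons true)))) (b []) ∧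
    (∀ σ : List Bool, σ.length < h → URealizes L D
      (A ∪ Set.range (treeTuple h (b ∘ List.cons true))) (b (false :: σ))) ∧
    GoodTree D E A h (b ∘ List.cons false) ∧ GoodTree D E A h (b ∘ List.cons true)

variable {L} {D E : Ultrafilter (Fin m → U)} {A : Set U}

/-- Each clause says that a node realizes an invariant type over other nodes, so it depends only on
the type of the tree over A. This makes the conjugate right half good. -/
theorem GoodTree.congr (hD : UInvariant L D A) (hE : UInvariant L E A) {h : ℕ}
    {b b' : List Bool → Fin m → U} (hb : GoodTree L D E A h b)
    (hbb : SameType L A (treeTuple h b) (treeTuple h b')) : GoodTree L D E A h b' := by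
  induction h generalizing b b' with
  | zero => trivial
  | succ h ih =>
    obtain ⟨h1, h2, h3, h4⟩ := hb
    let s (i : Bool) : {σ : List Bool // σ.length < h} × Fin m →
        {σ : List Bool // σ.length < h + 1} × Fin m :=
      fun x => (⟨i :: x.1.1, Nat.succ_lt_succ x.1.2⟩, x.2)
    refine ⟨hE.realizes_of_sameType h1 ?_, fun σ hσ => hD.realizes_of_sameType (h2 σ hσ) ?_,
      ih h3 (hbb.comp (s false)), ih h4 (hbb.comp (s true))⟩
    · convert hbb.comp (Sum.elim (fun i => (⟨[], Nat.succ_pos h⟩, i))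
        (Sum.elim (s false) (s true))) using 1 <;>
      · funext x
        rcases x with x | x | x <;> rfl
    · convert hbb.comp (Sum.elim (fun i => (⟨false :: σ, Nat.succ_lt_succ hσ⟩, i)) (s true))
        using 1 <;>
      · funext x
        rcases x with x | x <;> rfl

theorem GoodTree.realizes (hDE : ∀ Z : Set (Fin m → U), A.Definable L Z → (Z ∈ D ↔ Z ∈ E))
    {h : ℕ} {b : List Bool → Fin m → U} (hb : GoodTree L D E A h b) :
    ∀ σ : List Bool, σ.length < h → URealizes L D A (b σ) := by
  induction h generalizing b with
  | zero => intro σ hσ; omega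
  | succ h ih =>
    obtain ⟨h1, h2, h3, h4⟩ := hb
    intro σ hσ
    rcases σ with _ | ⟨i, σ⟩
    · exact fun Z hZ hZD => h1.mono Set.subset_union_left Z hZ ((hDE Z hZ).1 hZD)
    · cases i with
      | false => exact ih h3 σ (Nat.lt_of_succ_lt_succ hσ)
      | true => exact ih h4 σ (Nat.lt_of_succ_lt_succ hσ)

theorem exists_goodTree [Nonempty U] {κ : Cardinal.{w}} (hU : IsSaturated L U κ) (hκ : ℵ₀ ≤ κ)
    (hA : #A < κ) (hD : UBiInvariant L D A) (hE : UInvariant L E A)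
    (hDE : ∀ Z : Set (Fin m → U), A.Definable L Z → (Z ∈ D ↔ Z ∈ E)) (h : ℕ) :
    ∃ b, GoodTree L D E A h b := by
  induction h with
  | zero => exact ⟨fun _ _ => Classical.arbitrary U, trivial⟩
  | succ h ih =>
    obtain ⟨b, hb⟩ := ih
    have hfin : ∀ {ι : Type} [Finite ι] (f : ι → U), #↥(A ∪ Set.range f) < κ := fun f =>
      mk_union_lt hκ hA (mk_lt_of_finite hκ (Set.finite_range f))
    obtain ⟨a, ha⟩ := hU.exists_realizes_finite (hfin (treeTuple h b)) D
    -- The tree b realizes r over A and a; realizing r again over A and b gives the copy that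
    -- becomes the right half.
    obtain ⟨r, hr, har⟩ := hD.2 _ a (treeTuple h b) ha
    obtain ⟨c₀, hc₀⟩ := hU.exists_realizes_finite (hfin (treeTuple h b)) r
    let c : List Bool → Fin m → U := fun σ i =>
      if hσ : σ.length < h then c₀ (⟨σ, hσ⟩, i) else Classical.arbitrary U
    have hc : treeTuple h c = c₀ := by
      funext x
      obtain ⟨⟨σ, hσ⟩, i⟩ := x
      simp [treeTuple, c, hσ]
    have hbc : SameType L A (treeTuple h b) (treeTuple h c) := by
      rw [hc]
      exact (har.mono Set.subset_union_left).sameType (hc₀.mono Set.subset_union_left)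
    have hleft : ∀ σ : List Bool, σ.length < h →
        URealizes L D (A ∪ Set.range (treeTuple h c)) (b σ) := by
      intro σ hσ
      -- D and E agree over A, so every node of b, although it realizes E over nodes above it, has
      -- the type of a over A.
      have h1 : SameType L A a (b σ) :=
        (ha.mono Set.subset_union_left).sameType (hb.realizes hDE σ hσ)
      have h2 : SameType L A (Sum.elim (treeTuple h b) a) (Sum.elim c₀ (b σ)) := by
        -- By invariance of r, the pair (c, b σ) is conjugate to (b, a), and a realizes D over b.
        refine hr.sameType_elim har (hc₀.mono (Set.union_subset_union_right _ ?_)) h1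
        rintro _ ⟨i, rfl⟩
        exact ⟨(⟨σ, hσ⟩, i), rfl⟩
      refine hD.1.realizes_of_sameType ha ?_
      rw [hc]
      convert h2.comp Sum.swap using 1 <;> simp
    obtain ⟨e, he⟩ := hU.exists_realizes_finite
      (hfin (Sum.elim (treeTuple h b) (treeTuple h c))) E
    refine ⟨fun σ => match σ with
      | [] => e
      | false :: σ => b σ
      | true :: σ => c σ, he, hleft, hb, hb.congr hD.1 hE hbc⟩

theorem exists_eq_map_cons {i : Bool} {l : List (List Bool)} (h : ∀ σ ∈ l, [i] <+: σ) :
    ∃ l' : List (List Bool), l = l'.map (List.cons i) := by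
  refine ⟨l.map List.tail, ?_⟩
  rw [List.map_map]
  refine (List.map_id l).symm.trans (List.map_congr_left fun σ hσ => ?_)
  obtain ⟨τ, rfl⟩ := h σ hσ
  rfl

theorem ChainList.exists_eq_map_cons {l : List (List Bool)} (h : ChainList l)
    (hl : ∀ σ ∈ l, σ ≠ []) :
    ∃ (i : Bool) (l' : List (List Bool)), l = l'.map (List.cons i) ∧ ChainList l' := by
  have : ∃ i : Bool, ∀ σ ∈ l, [i] <+: σ := by
    rcases l with _ | ⟨σ, l⟩
    · exact ⟨false, by simp⟩
    · rcases σ with _ | ⟨i, σ⟩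
      · exact absurd rfl (hl [] List.mem_cons_self)
      · refine ⟨i, fun τ hτ => ?_⟩
        rcases List.mem_cons.1 hτ with rfl | hτ
        · simp
        · exact List.IsPrefix.trans (by simp) ((List.pairwise_cons.1 h).1 τ hτ).1
  obtain ⟨i, hi⟩ := this
  obtain ⟨l', rfl⟩ := CombTree.exists_eq_map_cons hi
  exact ⟨i, l', rfl, by simpa [ChainList, List.pairwise_map] using h⟩

theorem CombList.of_map_cons {i : Bool} {l : List (List Bool)}
    (h : CombList (l.map (List.cons i))) : CombList l := by
  generalize hr : l.map (List.cons i) = r at h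
  induction h generalizing l with
  | nil => rw [List.map_eq_nil_iff.1 hr]; exact CombList.nil
  | single s =>
    obtain ⟨t, rfl, -⟩ := List.map_eq_singleton_iff.1 hr
    exact CombList.single t
  | cons σ s r hs hr' _ ih =>
    obtain ⟨t, l, rfl, rfl, rfl⟩ := List.map_eq_cons_iff.1 hr
    -- All nodes begin with the same i, so a branching at the root is only possible when nothing
    -- follows the first node.
    rcases σ with _ | ⟨j, σ⟩
    · rcases l with _ | ⟨t', l⟩
      · exact CombList.single t
      · simp at hs hr'
        simp_all
    · refine CombList.cons σ t l ?_ (fun t' ht' => ?_) (ih rfl)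
      · simpa using (List.cons_prefix_cons.1 hs).2
      · exact (List.cons_prefix_cons.1 (hr' _ (List.mem_map_of_mem ht'))).2

theorem listParams_subset_range_treeTuple {h : ℕ} {b : List Bool → Fin m → U} {i : Bool}
    {l : List (List Bool)} (hl : ∀ σ ∈ l, (i :: σ).length < h + 1) :
    listParams ((l.map (List.cons i)).map b) ⊆ Set.range (treeTuple h (b ∘ List.cons i)) := by
  rintro x ⟨y, hy, j, rfl⟩
  simp only [List.map_map, List.mem_map] at hy
  obtain ⟨σ, hσ, rfl⟩ := hy
  exact ⟨(⟨σ, Nat.lt_of_succ_lt_succ (hl σ hσ)⟩, j), rfl⟩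

/-- The root realizes E over all nodes above it, so it is the latest member of the Morley sequence.
A chain avoiding the root lies in one half, where induction applies. -/
theorem GoodTree.morleyList_of_chain {h : ℕ} {b : List Bool → Fin m → U}
    (hb : GoodTree L D E A h b) {l : List (List Bool)} (hl : ChainList l)
    (hlen : ∀ σ ∈ l, σ.length < h) : MorleyList L E A (l.map b) := by
  induction h generalizing b l with
  | zero =>
    rcases l with _ | ⟨σ, l⟩
    · trivial
    · exact absurd (hlen σ List.mem_cons_self) (by omega)
  | succ h ih =>
    obtain ⟨h1, -, h3, h4⟩ := hb
    have key : ∀ l, ChainList l → (∀ σ ∈ l, σ.length < h + 1) → (∀ σ ∈ l, σ ≠ []) →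
        MorleyList L E A (l.map b) ∧ listParams (l.map b) ⊆ Set.range
          (Sum.elim (treeTuple h (b ∘ List.cons false)) (treeTuple h (b ∘ List.cons true))) := by
      intro l hl hlen hne
      obtain ⟨i, l', rfl, hl'⟩ := hl.exists_eq_map_cons hne
      have hlen' : ∀ σ ∈ l', (i :: σ).length < h + 1 := by simpa using hlen
      have hsub := listParams_subset_range_treeTuple (b := b) hlen'
      rw [List.map_map] at hsub ⊢
      rw [Set.Sum.elim_range]
      cases i with
      | false =>
        exact ⟨ih h3 hl' fun σ hσ => Nat.lt_of_succ_lt_succ (hlen' σ hσ),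
          hsub.trans Set.subset_union_left⟩
      | true =>
        exact ⟨ih h4 hl' fun σ hσ => Nat.lt_of_succ_lt_succ (hlen' σ hσ),
          hsub.trans Set.subset_union_right⟩
    by_cases hne : ∀ σ ∈ l, σ ≠ []
    · exact (key l hl hlen hne).1
    · rcases l with _ | ⟨σ, l⟩
      · trivial
      have hl2 := List.pairwise_cons.1 hl
      have hne' : ∀ τ ∈ l, τ ≠ [] := by
        rintro τ hτ rfl
        obtain ⟨h1, h2⟩ := hl2.1 [] hτ
        exact h2 (List.prefix_nil.1 h1)
      have hσ : σ = [] := by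
        by_contra hσ
        exact hne fun τ hτ => by
          rcases List.mem_cons.1 hτ with rfl | hτ
          · exact hσ
          · exact hne' τ hτ
      subst hσ
      obtain ⟨k1, k2⟩ := key l hl2.2 (fun σ hσ => hlen σ (List.mem_cons_of_mem _ hσ)) hne'
      exact ⟨h1.mono (Set.union_subset_union_right _ k2), k1⟩

/-- If the comb branches at the root, its first node is on the left and realizes D over the right
half, which contains the rest; otherwise a comb with at least two nodes lies in one half. -/
theorem GoodTree.morleyList_of_comb
    (hDE : ∀ Z : Set (Fin m → U), A.Definable L Z → (Z ∈ D ↔ Z ∈ E)) {h : ℕ}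
    {b : List Bool → Fin m → U} (hb : GoodTree L D E A h b) {l : List (List Bool)}
    (hl : CombList l) (hlen : ∀ σ ∈ l, σ.length < h) : MorleyList L D A (l.map b) := by
  induction h generalizing b l with
  | zero =>
    rcases l with _ | ⟨σ, l⟩
    · trivial
    · exact absurd (hlen σ List.mem_cons_self) (by omega)
  | succ h ih =>
    have hreal := hb.realizes hDE
    obtain ⟨-, h2, h3, h4⟩ := hb
    have key : ∀ i l, CombList l → (∀ σ ∈ l, σ.length < h + 1) → (∀ σ ∈ l, [i] <+: σ) →
        MorleyList L D A (l.map b) ∧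
          listParams (l.map b) ⊆ Set.range (treeTuple h (b ∘ List.cons i)) := by
      intro i l hl hlen hi
      obtain ⟨l', rfl⟩ := exists_eq_map_cons hi
      have hlen' : ∀ σ ∈ l', (i :: σ).length < h + 1 := by simpa using hlen
      refine ⟨?_, listParams_subset_range_treeTuple hlen'⟩
      rw [List.map_map]
      cases i with
      | false => exact ih h3 hl.of_map_cons fun σ hσ => Nat.lt_of_succ_lt_succ (hlen' σ hσ)
      | true => exact ih h4 hl.of_map_cons fun σ hσ => Nat.lt_of_succ_lt_succ (hlen' σ hσ)
    rcases hl with _ | s | ⟨σ, s, l, hs, hl, hcl⟩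
    · trivial
    · exact ⟨(hreal s (hlen s (by simp))).mono (by simp [listParams]), trivial⟩
    · rcases σ with _ | ⟨i, σ⟩
      · obtain ⟨s, rfl⟩ := hs
        obtain ⟨k1, k2⟩ := key true l hcl
          (fun σ hσ => hlen σ (List.mem_cons_of_mem _ hσ)) (by simpa using hl)
        exact ⟨(h2 s (Nat.lt_of_succ_lt_succ (hlen _ List.mem_cons_self))).mono
          (Set.union_subset_union_right _ k2), k1⟩
      · refine (key i (s :: l) (CombList.cons (i :: σ) s l hs hl hcl) hlen ?_).1
        intro τ hτ
        rcases List.mem_cons.1 hτ with rfl | hτ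
        · exact List.IsPrefix.trans (by simp) hs
        · exact List.IsPrefix.trans (by simp) (hl τ hτ)

end GoodTrees

/-! ### From a failure of Kim's lemma to the comb tree property -/

section KimsLemma

variable {L : FirstOrder.Language.{u, v}} {T : L.Theory} {U : Type w} [L.Structure U] [Nonempty U]
  [U ⊨ T] {κ : Cardinal.{w}} {n m : ℕ} {φ : L.Formula (Fin n ⊕ Fin m)}

/-- Compactness: each comb or chain condition mentions finitely many nodes, so it holds in the tree
of height h for all large h. -/
theorem hasCTP_of_goodTrees (hU : IsSaturated L U κ) (hκ : ℵ₀ ≤ κ) {k : ℕ}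
    (b : ℕ → List Bool → Fin m → U)
    (hb : ∀ h l, CombList l → (∀ σ ∈ l, σ.length < h) → Solvable φ (l.map (b h)))
    (hb' : ∀ h l, ChainList l → (∀ σ ∈ l, σ.length < h) → l.length = k →
      ¬ Solvable φ (l.map (b h))) : HasCTP T := by
  let S1 : Set (Set (List Bool × Fin m → U)) :=
    {s | ∃ l, CombList l ∧ s = {v | (solvableFormula φ l).Realize v}}
  let S2 : Set (Set (List Bool × Fin m → U)) :=
    {s | ∃ l, ChainList l ∧ l.length = k ∧ s = {v | ¬ (solvableFormula φ l).Realize v}}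
  have hlarge : ∀ l : List (List Bool), ∀ᶠ h in Filter.atTop, ∀ σ ∈ l, σ.length < h := by
    intro l
    have := (Filter.eventually_all_finset (l := Filter.atTop) l.toFinset
      (p := fun σ h => σ.length < h)).2 fun σ _ => Filter.eventually_gt_atTop _
    simpa using this
  have hS : ∀ s ∈ S1 ∪ S2, ∀ᶠ h in Filter.atTop, (fun x => b h x.1 x.2) ∈ s := by
    rintro s (⟨l, hl, rfl⟩ | ⟨l, hl, hk, rfl⟩)
    · filter_upwards [hlarge l] with h hh
      exact realize_solvableFormula.2 (hb h l hl hh)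
    · filter_upwards [hlarge l] with h hh
      exact fun hn => hb' h l hl hh hk (realize_solvableFormula.1 hn)
  obtain ⟨v, hv⟩ := hU.exists_mem hκ (A := ∅) (by simpa using Cardinal.aleph0_pos.trans_le hκ)
    (S1 ∪ S2)
    (by
      rintro s (⟨l, hl, rfl⟩ | ⟨l, hl, hk, rfl⟩)
      · exact definable_realize _ _
      · exact (definable_realize _ _).compl)
    (by
      intro F hF
      obtain ⟨h, hh⟩ := ((Filter.eventually_all_finset F).2 fun s hs => hS s (hF hs)).exists
      exact ⟨_, hh⟩)
  refine ⟨k, hasKCTP_of_isCombTree (φ := φ) (b := fun σ i => v (σ, i)) (isCombTree_nil_iff.2 ?_)⟩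
  exact ⟨fun l hl => hv _ (Or.inl ⟨l, hl, rfl⟩), fun l hl hk => hv _ (Or.inr ⟨l, hl, hk, rfl⟩)⟩

/-- If Kim's lemma fails for a bi-invariant type, then the theory has the comb tree property. -/
theorem hasCTP_of_isBiInvariant (hU : IsSaturated L U κ) (hκ : ℵ₀ ≤ κ) {A : Set U} (hA : #A < κ)
    {p q : GlobalType L U m} (hp : p.IsBiInvariant A) (hq : q.IsInvariant A) (hpq : p.EqOn q A)
    (hqφ : q.KimDivides A φ) (hpφ : ¬ p.KimDivides A φ) : HasCTP T := by
  obtain ⟨D, hD⟩ := exists_ultrafilter_represents p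
  obtain ⟨E, hE⟩ := exists_ultrafilter_represents q
  have hDE := (hD.eqOn_iff hE).1 hpq
  have hDinv := hD.uBiInvariant hp
  have hEinv := hE.isInvariant_iff.1 hq
  obtain ⟨e, he, hec⟩ := hqφ
  have he := (isMorley_iff hE).1 he
  obtain ⟨k, hk⟩ := exists_not_solvable_of_not_consistent hec
  obtain ⟨d, hd⟩ := hU.exists_morley hκ hA D
  have hdsol : ∀ N, Solvable φ ((List.range N).reverse.map d) := by
    intro N
    by_contra hN
    exact hpφ ⟨d, (isMorley_iff hD).2 hd, not_consistent_of_not_solvable hN⟩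
  choose b hb using exists_goodTree hU hκ hA hDinv hEinv hDE
  refine hasCTP_of_goodTrees (φ := φ) hU hκ (k := k) b (fun h l hl hlen => ?_) fun h l hl hlen hlk => ?_
  · refine (((hb h).morleyList_of_comb hDE hl hlen).solvable_iff hDinv.1
      (MorleyList.of_seq hd l.length) (by simp)).2 (hdsol _)
  · rw [((hb h).morleyList_of_chain hl hlen).solvable_iff hEinv
      (MorleyList.of_seq he k) (by simp [hlk])]
    exact hk

end KimsLemma

/-! ### Coheirs are invariant, heir-coheirs are bi-invariant -/

section Coheirs

variable {L : FirstOrder.Language.{u, v}} {U : Type w} [L.Structure U] {m : ℕ}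

theorem definable_slice_right {α β : Type} {A : Set U} {R : Set (α ⊕ β → U)}
    (hR : A.Definable L R) {a : α → U} (ha : ∀ i, a i ∈ A) :
    A.Definable L {b : β → U | Sum.elim a b ∈ R} := by
  convert definable_slice (hR.preimage_comp Sum.swap) subset_rfl ha using 3
  rw [Set.mem_preimage]
  simp

variable [Nonempty U]

/-- If p contained ψ(y, b) and ¬ψ(y, b'), a tuple from A would satisfy both and so distinguish b
from b' over A. -/
theorem GlobalType.IsCoheir.isInvariant {p : GlobalType L U m} {A : Set U} (hp : p.IsCoheir A) :
    p.IsInvariant A := by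
  obtain ⟨D, hD⟩ := exists_ultrafilter_represents p
  rw [hD.isInvariant_iff]
  have hco := hD.isCoheir_iff.1 hp
  have key : ∀ (β : Type) [Finite β] (R : Set (Fin m ⊕ β → U)), A.Definable L R →
      ∀ b b' : β → U, SameType L A b b' → {a | Sum.elim a b ∈ R} ∈ D →
        {a | Sum.elim a b' ∈ R} ∈ D := by
    intro β _ R hR b b' hbb hb
    by_contra hb'
    have hslice : ∀ b : β → U, (Set.univ : Set U).Definable L {a | Sum.elim a b ∈ R} :=
      fun b => definable_slice hR (Set.subset_univ _) fun i => Set.mem_univ _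
    obtain ⟨a, ⟨ha1, ha2⟩, haA⟩ := hco _ ((hslice b).inter (hslice b').compl)
      (Filter.inter_mem hb (Ultrafilter.compl_mem_iff_notMem.2 hb'))
    exact ha2 ((hbb _ (definable_slice_right hR haA)).1 ha1)
  exact fun β _ R hR b b' hbb => ⟨key β R hR b b' hbb, key β R hR b' b hbb.symm⟩

theorem GlobalType.IsHeirCoheir.isBiInvariant {p : GlobalType L U m} {A : Set U}
    (hp : p.IsHeirCoheir A) : p.IsBiInvariant A := by
  refine ⟨hp.2.isInvariant, fun n a b hab => ?_⟩
  obtain ⟨D, hD⟩ := exists_ultrafilter_represents p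
  have hheir := hD.isHeir_iff.1 hp.1
  rw [hD.realizes_iff] at hab
  -- The heir property makes the type of b over A and a finitely satisfiable in A; an ultrafilter
  -- concentrating on tuples from A then gives a coheir extension.
  obtain ⟨F, hF⟩ := exists_ultrafilter_of_inter
    {W : Set (Fin n → U) | ∃ Z, (A ∪ Set.range a).Definable L Z ∧ b ∈ Z ∧
      W = {z | z ∈ Z ∧ ∀ i, z i ∈ A}}
    ⟨_, Set.univ, Set.definable_univ, Set.mem_univ b, rfl⟩
    (by
      rintro _ ⟨Z, hZ, hb, rfl⟩ _ ⟨Z', hZ', hb', rfl⟩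
      refine ⟨Z ∩ Z', hZ.inter hZ', ⟨hb, hb'⟩, ?_⟩
      ext z
      simp only [Set.mem_inter_iff, Set.mem_ofPred_eq]
      tauto)
    (by
      rintro _ ⟨Z, hZ, hb, rfl⟩
      obtain ⟨R, hR, rfl⟩ := exists_slice hZ
      have hslice : ∀ b : Fin n → U,
          {y : Fin m → U | Sum.elim y b ∈ (fun g => g ∘ Sum.swap) ⁻¹' R} =
            {y | Sum.elim b y ∈ R} := by
        intro b
        ext y
        simp
      have hR' := hR.preimage_comp (Sum.swap : Fin n ⊕ Fin m → Fin m ⊕ Fin n)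
      have h1 := (hab.iff (definable_slice hR' Set.subset_union_left (b := b)
        fun i => Or.inr (Set.mem_range_self i))).1 (by rw [hslice]; exact hb)
      obtain ⟨b', hb'A, hb'⟩ := hheir n _ hR' b h1
      have h2 := (hab.iff (definable_slice hR' Set.subset_union_left (b := b')
        fun i => Or.inl (hb'A i))).2 hb'
      rw [hslice] at h2
      exact ⟨b', h2, hb'A⟩)
  obtain ⟨r, hr⟩ := exists_globalType_of_ultrafilter (L := L) F
  refine ⟨r, GlobalType.IsCoheir.isInvariant (hr.isCoheir_iff.2 fun Z _ hZF => ?_),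
    hr.realizes_iff.2 fun Z hZ hZF => ?_⟩
  · obtain ⟨z, hz1, hz2⟩ := Ultrafilter.nonempty_of_mem
      (Filter.inter_mem hZF (hF _ ⟨Set.univ, Set.definable_univ, Set.mem_univ b, rfl⟩))
    exact ⟨z, hz1, hz2.2⟩
  · by_contra hb
    obtain ⟨z, hz1, hz2⟩ := Ultrafilter.nonempty_of_mem
      (Filter.inter_mem hZF (hF _ ⟨Zᶜ, hZ.compl, hb, rfl⟩))
    exact hz2.1 hz1

end Coheirs

/-! ### Parameter sets no larger than the set of formulas -/

section Cardinality

variable (L : FirstOrder.Language.{u, v}) {U : Type w} {m : ℕ}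

/-- The set has at most as many elements as there are formulas. -/
def FewParams {X : Type w} (A : Set X) : Prop :=
  Cardinal.lift.{max u v} #A ≤ Cardinal.lift.{w} (max ℵ₀ L.card)

/-- Relations between `m`-tuples and tuples, together with a tuple of the latter kind. -/
abbrev Instance (U : Type w) (m : ℕ) : Type w := Σ l : ℕ, Set (Fin m ⊕ Fin l → U) × (Fin l → U)

variable {L}

theorem aleph0_le_lift_card : ℵ₀ ≤ Cardinal.lift.{w} (max ℵ₀ L.card) :=
  Cardinal.aleph0_le_lift.2 (le_max_left _ _)

theorem FewParams.lt {κ : Cardinal.{w}} {A : Set U} (h : FewParams L A)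
    (hκ : Cardinal.lift.{w} (max ℵ₀ L.card) < Cardinal.lift.{max u v} κ) : #A < κ :=
  Cardinal.lift_lt.1 (h.trans_lt hκ)

theorem FewParams.of_countable {A : Set U} (h : A.Countable) : FewParams L A :=
  (Cardinal.lift_le_aleph0.2 h.le_aleph0).trans aleph0_le_lift_card

theorem FewParams.union {A B : Set U} (hA : FewParams L A) (hB : FewParams L B) :
    FewParams L (A ∪ B) := by
  refine (Cardinal.lift_le.2 (Cardinal.mk_union_le A B)).trans ?_
  rw [Cardinal.lift_add]
  exact Cardinal.add_le_of_le aleph0_le_lift_card hA hB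

theorem FewParams.iUnion_nat {A : ℕ → Set U} (hA : ∀ n, FewParams L (A n)) :
    FewParams L (⋃ n, A n) := by
  have h := Cardinal.mk_iUnion_le_lift A
  rw [Cardinal.lift_id'.{0, w}] at h
  refine (Cardinal.lift_le.2 h).trans ?_
  rw [Cardinal.lift_mul]
  refine Cardinal.mul_le_of_le aleph0_le_lift_card (by simp) ?_
  rw [Cardinal.lift_iSup (Cardinal.bddAbove_of_small)]
  refine ciSup_le' fun n => ?_
  rw [Cardinal.lift_id'.{0, w}]
  exact hA n

theorem FewParams.biUnion_range {G : Set (Instance U m)} (hG : FewParams L G) :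
    FewParams L (⋃ g ∈ G, Set.range g.2.2) := by
  refine (Cardinal.lift_le.2 (Cardinal.mk_biUnion_le _ G)).trans ?_
  rw [Cardinal.lift_mul]
  refine Cardinal.mul_le_of_le aleph0_le_lift_card hG ?_
  refine le_trans ?_ aleph0_le_lift_card
  rw [Cardinal.lift_le_aleph0]
  exact ciSup_le' fun g => (Set.finite_range g.1.2.2).countable.le_aleph0

theorem FewParams.formula {A : Set U} (hA : FewParams L A) (α : Type) [Countable α] :
    #(L[[A]].Formula α) ≤ Cardinal.lift.{w} (max ℵ₀ L.card) := by
  have h1 : #(L[[A]].Formula α) ≤ #(Σ n, L[[A]].BoundedFormula α n) :=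
    Cardinal.mk_le_of_injective (f := fun φ => ⟨0, φ⟩) fun φ ψ h => by simpa using h
  refine h1.trans (BoundedFormula.card_le.trans (max_le aleph0_le_lift_card ?_))
  refine Cardinal.add_le_of_le aleph0_le_lift_card ?_ ?_
  · exact (Cardinal.lift_le_aleph0.2 (Cardinal.mk_le_aleph0)).trans aleph0_le_lift_card
  · rw [Cardinal.lift_id'.{0}, card_withConstants]
    exact Cardinal.add_le_of_le aleph0_le_lift_card (Cardinal.lift_le.2 (le_max_right _ _)) hA

variable [L.Structure U]

/-- A set of relations definable over few parameters, with at most one tuple for each relation,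
is small. -/
theorem FewParams.of_functional {A : Set U} (hA : FewParams L A) {G : Set (Instance U m)}
    (hdef : ∀ g ∈ G, A.Definable L g.2.1)
    (hfun : ∀ l R b b', (⟨l, R, b⟩ : Instance U m) ∈ G → (⟨l, R, b'⟩ : Instance U m) ∈ G → b = b') :
    FewParams L G := by
  choose f hf using fun g : G => hdef g g.2
  -- A defining formula determines the relation, and the relation determines the tuple, so there are
  -- no more elements than formulas over A.
  let F : G → Σ l : ℕ, L[[A]].Formula (Fin m ⊕ Fin l) := fun g => ⟨g.1.1, f g⟩
  have hF : Function.Injective F := by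
    rintro ⟨⟨l, R, b⟩, hg⟩ ⟨⟨l', R', b'⟩, hg'⟩ h
    have h0 : l = l' := congrArg Sigma.fst h
    subst h0
    have h1 : f ⟨⟨l, R, b⟩, hg⟩ = f ⟨⟨l, R', b'⟩, hg'⟩ := by simpa [F] using h
    have h2 : R = R' := (hf ⟨⟨l, R, b⟩, hg⟩).trans (by rw [h1]; exact (hf ⟨⟨l, R', b'⟩, hg'⟩).symm)
    subst h2
    have := hfun l R b b' hg hg'
    subst this
    rfl
  rw [FewParams, ← Cardinal.lift_umax.{w, max u v}]
  refine (Cardinal.lift_mk_le_lift_mk_of_injective hF).trans ?_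
  rw [Cardinal.lift_id'.{w}, Cardinal.mk_sigma]
  refine (Cardinal.sum_le_sum _ (fun _ => Cardinal.lift.{w} (max ℵ₀ L.card))
    fun l => hA.formula _).trans ?_
  rw [Cardinal.sum_const]
  refine Cardinal.mul_le_of_le aleph0_le_lift_card (by simp) ?_
  rw [Cardinal.lift_id'.{0}]

end Cardinality

/-! ### One stage of the construction: maximal sets of instances -/

section Stages

variable {L : FirstOrder.Language.{u, v}} {U : Type w} [L.Structure U] {n m : ℕ}

/-- `b` is a tree relative to `C` and `Q` all of whose nodes lie in all sets in `F`. -/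
def IsTreeIn (φ : L.Formula (Fin n ⊕ Fin m)) (k : ℕ) (C Q : Set (List (Fin m → U)))
    (F : Set (Set (Fin m → U))) (b : List Bool → Fin m → U) : Prop :=
  IsCombTree φ k C Q b ∧ ∀ X ∈ F, ∀ σ, b σ ∈ X

/-- The set of tuples in the given relation with the given tuple. -/
def Instance.slice (g : Instance U m) : Set (Fin m → U) := {y | Sum.elim y g.2.2 ∈ g.2.1}

variable {φ : L.Formula (Fin n ⊕ Fin m)} {k : ℕ} {C Q : Set (List (Fin m → U))}
  {F : Set (Set (Fin m → U))} {A : Set U}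

/-- A set of relations with parameters, functional in the parameters, which is satisfied by the
nodes of some tree. -/
structure IsAdmissible (φ : L.Formula (Fin n ⊕ Fin m)) (k : ℕ) (C Q : Set (List (Fin m → U)))
    (F : Set (Set (Fin m → U))) (A : Set U) (G : Set (Instance U m)) : Prop where
  definable : ∀ g ∈ G, A.Definable L g.2.1
  functional : ∀ l R b b', (⟨l, R, b⟩ : Instance U m) ∈ G → (⟨l, R, b'⟩ : Instance U m) ∈ G → b = b'
  exists_tree : ∃ t, IsTreeIn φ k C Q (F ∪ Instance.slice '' G) t

theorem definable_treeNode {B : Set U} {X : Set (Fin m → U)} (hX : B.Definable L X)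
    (σ : List Bool) :
    B.Definable L {v : List Bool × Fin m → U | (fun i => v (σ, i)) ∈ X} :=
  hX.preimage_comp fun i => (σ, i)

/-- The required tree realizes a partial type in countably many variables, finitely satisfied by the
trees of the members of the chain. Functionality keeps its parameters few, so saturation applies. -/
theorem IsAdmissible.sUnion [Nonempty U] {κ : Cardinal.{w}} (hU : IsSaturated L U κ)
    (hκ : Cardinal.lift.{w} (max ℵ₀ L.card) < Cardinal.lift.{max u v} κ) (hκ' : ℵ₀ ≤ κ)
    (hA : FewParams L A) (hC : ∀ c ∈ C, ∀ y ∈ c, ∀ i, y i ∈ A) (hQ : ∀ c ∈ Q, ∀ y ∈ c, ∀ i, y i ∈ A)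
    (hF : ∀ X ∈ F, A.Definable L X) {c : Set (Set (Instance U m))} (hne : c.Nonempty)
    (hc : IsChain (· ⊆ ·) c) (h : ∀ G ∈ c, IsAdmissible φ k C Q F A G) :
    IsAdmissible φ k C Q F A (⋃₀ c) := by
  have hdef : ∀ g ∈ ⋃₀ c, A.Definable L g.2.1 := by
    rintro g ⟨G, hG, hg⟩
    exact (h G hG).definable g hg
  have hfun : ∀ l R b b', (⟨l, R, b⟩ : Instance U m) ∈ ⋃₀ c →
      (⟨l, R, b'⟩ : Instance U m) ∈ ⋃₀ c → b = b' := by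
    rintro l R b b' ⟨G, hG, hg⟩ ⟨G', hG', hg'⟩
    rcases hc.total hG hG' with hGG | hGG
    · exact (h G' hG').functional l R b b' (hGG hg) hg'
    · exact (h G hG).functional l R b b' hg (hGG hg')
  refine ⟨hdef, hfun, ?_⟩
  let B := A ∪ ⋃ g ∈ ⋃₀ c, Set.range g.2.2
  have hB : FewParams L B := hA.union (hA.of_functional hdef hfun).biUnion_range
  let S : Set (Instance U m) → Set (Set (List Bool × Fin m → U)) := fun G =>
    {s | ∃ c ∈ C, ∃ l, CombList l ∧ s = {v | Solvable φ (c ++ l.map fun σ i => v (σ, i))}} ∪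
    {s | ∃ c ∈ Q, ∃ l, ChainList l ∧ c.length + l.length = k ∧
      s = {v | Solvable φ (c ++ l.map fun σ i => v (σ, i))}ᶜ} ∪
    {s | ∃ X ∈ F ∪ Instance.slice '' G, ∃ σ, s = {v | (fun i => v (σ, i)) ∈ X}}
  have hS : ∀ (G : Set (Instance U m)) (v : List Bool × Fin m → U),
      (∀ s ∈ S G, v ∈ s) ↔ IsTreeIn φ k C Q (F ∪ Instance.slice '' G) fun σ i => v (σ, i) := by
    intro G v
    constructor
    · intro hv
      exact ⟨⟨fun c hc l hl => hv _ (Or.inl (Or.inl ⟨c, hc, l, hl, rfl⟩)),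
        fun c hc l hl hk => hv _ (Or.inl (Or.inr ⟨c, hc, l, hl, hk, rfl⟩))⟩,
        fun X hX σ => hv _ (Or.inr ⟨X, hX, σ, rfl⟩)⟩
    · rintro ⟨⟨h1, h2⟩, h3⟩ s ((⟨c, hc, l, hl, rfl⟩ | ⟨c, hc, l, hl, hk, rfl⟩) | ⟨X, hX, σ, rfl⟩)
      · exact h1 c hc l hl
      · exact h2 c hc l hl hk
      · exact h3 X hX σ
  have hdir : DirectedOn (fun G G' => S G ⊆ S G') c := by
    intro G hG G' hG'
    have hmono : ∀ {G G'}, G ⊆ G' → S G ⊆ S G' := by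
      intro G G' hGG
      refine Set.union_subset_union_right _ ?_
      rintro s ⟨X, hX, σ, rfl⟩
      exact ⟨X, Set.union_subset_union_right _ (Set.image_mono hGG) hX, σ, rfl⟩
    rcases hc.total hG hG' with hGG | hGG
    · exact ⟨G', hG', hmono hGG, subset_rfl⟩
    · exact ⟨G, hG, subset_rfl, hmono hGG⟩
  obtain ⟨v, hv⟩ := hU.exists_mem hκ' (hB.lt hκ) (S (⋃₀ c))
    (by
      rintro s ((⟨c, hc, l, hl, rfl⟩ | ⟨c, hc, l, hl, hk, rfl⟩) | ⟨X, hX | ⟨g, hg, rfl⟩, σ, rfl⟩)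
      · exact (definable_solvable_tree φ (hC c hc) l).mono Set.subset_union_left
      · exact ((definable_solvable_tree φ (hQ c hc) l).mono Set.subset_union_left).compl
      · exact definable_treeNode ((hF X hX).mono Set.subset_union_left) σ
      · refine definable_treeNode (definable_slice (hdef g hg) Set.subset_union_left
          fun i => Or.inr (Set.mem_biUnion hg (Set.mem_range_self i))) σ)
    (by
      intro T hT
      have hTU : (T : Set (Set (List Bool × Fin m → U))) ⊆ ⋃ G ∈ c, S G := by
        intro s hs
        obtain ⟨G₀, hG₀⟩ := hne
        rcases hT hs with h1 | ⟨X, hX | ⟨g, ⟨G, hG, hg⟩, rfl⟩, σ, rfl⟩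
        · exact Set.mem_biUnion hG₀ (Or.inl h1)
        · exact Set.mem_biUnion hG₀ (Or.inr ⟨X, Or.inl hX, σ, rfl⟩)
        · exact Set.mem_biUnion hG (Or.inr ⟨_, Or.inr ⟨g, hg, rfl⟩, σ, rfl⟩)
      obtain ⟨G, hG, hTG⟩ := DirectedOn.exists_mem_subset_of_finset_subset_biUnion hne hdir hTU
      obtain ⟨t, ht⟩ := (h G hG).exists_tree
      exact ⟨fun x => t x.1 x.2, fun s hs => (hS G _).2 ht s (hTG hs)⟩)
  exact ⟨_, (hS _ v).1 hv⟩

/-- A maximal admissible set decides which relations can be satisfied by trees. -/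
theorem exists_maximal_isAdmissible [Nonempty U] {κ : Cardinal.{w}} (hU : IsSaturated L U κ)
    (hκ : Cardinal.lift.{w} (max ℵ₀ L.card) < Cardinal.lift.{max u v} κ) (hκ' : ℵ₀ ≤ κ)
    (hA : FewParams L A) (hC : ∀ c ∈ C, ∀ y ∈ c, ∀ i, y i ∈ A) (hQ : ∀ c ∈ Q, ∀ y ∈ c, ∀ i, y i ∈ A)
    (hF : ∀ X ∈ F, A.Definable L X) (ht : ∃ t, IsTreeIn φ k C Q F t) :
    ∃ G : Set (Instance U m), IsAdmissible φ k C Q F A G ∧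
      ∀ (l : ℕ) (R : Set (Fin m ⊕ Fin l → U)), A.Definable L R → ∀ b : Fin l → U,
        (∃ t, IsTreeIn φ k C Q (F ∪ Instance.slice '' G) t ∧ ∀ σ, Sum.elim (t σ) b ∈ R) →
          ∃ b' : Fin l → U, (⟨l, R, b'⟩ : Instance U m) ∈ G := by
  obtain ⟨G, -, hG⟩ := zorn_subset_nonempty {G | IsAdmissible φ k C Q F A G}
    (fun c hcS hc hne => ⟨⋃₀ c, IsAdmissible.sUnion hU hκ hκ' hA hC hQ hF hne hc hcS,
      fun s hs => Set.subset_sUnion_of_mem hs⟩)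
    ∅ ⟨by simp, by simp, by simpa using ht⟩
  refine ⟨G, hG.prop, ?_⟩
  rintro l R hR b ⟨t, ht, htR⟩
  by_contra hn
  push Not at hn
  -- No tuple is yet attached to R, so adding (R, b) keeps the set functional, and t is the required
  -- tree; this contradicts maximality.
  have hadm : IsAdmissible φ k C Q F A (insert ⟨l, R, b⟩ G) := by
    refine ⟨?_, ?_, t, ht.1, ?_⟩
    · rintro g (rfl | hg)
      · exact hR
      · exact hG.prop.definable g hg
    · rintro l' R' b₁ b₂ (h1 | h1) (h2 | h2)
      · have := h1.trans h2.symm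
        simpa using this
      · cases h1
        exact absurd h2 (hn _)
      · cases h2
        exact absurd h1 (hn _)
      · exact hG.prop.functional _ _ _ _ h1 h2
    · rintro X (hX | ⟨g, rfl | hg, rfl⟩) σ
      · exact ht.2 X (Or.inl hX) σ
      · exact htR σ
      · exact ht.2 _ (Or.inr ⟨g, hg, rfl⟩) σ
  exact hn b (hG.le_of_ge hadm (Set.subset_insert _ _) (Set.mem_insert _ _))

/-- The data of a stage of the construction: a set of parameters, contexts for combs and for
chains, and a partial type. -/
structure Stage (U : Type w) (m : ℕ) where
  /-- The parameters. -/
  params : Set U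
  /-- The context for combs. -/
  combs : Set (List (Fin m → U))
  /-- The context for chains. -/
  chains : Set (List (Fin m → U))
  /-- The partial type. -/
  type : Set (Set (Fin m → U))

/-- The parameters of a stage are few, the other data are over them, and there is a tree. -/
structure Stage.IsGood (φ : L.Formula (Fin n ⊕ Fin m)) (k : ℕ) (s : Stage U m) : Prop where
  few : FewParams L s.params
  combs_mem : ∀ c ∈ s.combs, ∀ y ∈ c, ∀ i, y i ∈ s.params
  chains_mem : ∀ c ∈ s.chains, ∀ y ∈ c, ∀ i, y i ∈ s.params
  definable : ∀ X ∈ s.type, s.params.Definable L X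
  exists_tree : ∃ t, IsTreeIn φ k s.combs s.chains s.type t

/-- The stage `s'` extends `s` by the nodes of the tree `B` and by the tuple `a`. -/
structure Stage.Next (φ : L.Formula (Fin n ⊕ Fin m)) (k : ℕ) (s s' : Stage U m)
    (B : List Bool → Fin m → U) (a : Fin m → U) : Prop where
  params_subset : s.params ⊆ s'.params
  type_subset : s.type ⊆ s'.type
  combs_subset : s.combs ⊆ s'.combs
  chains_subset : s.chains ⊆ s'.chains
  isTreeIn : IsTreeIn φ k s.combs s.chains s'.type B
  mem : ∀ X ∈ s'.type, a ∈ X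
  tree_mem : ∀ σ i, B σ i ∈ s'.params
  point_mem : ∀ i, a i ∈ s'.params
  append_tree : ∀ c ∈ s.combs, ∀ σ, c ++ [B σ] ∈ s'.combs
  append_point : ∀ c ∈ s.chains, c ++ [a] ∈ s'.chains
  heir : ∀ (l : ℕ) (R : Set (Fin m ⊕ Fin l → U)), s.params.Definable L R → ∀ b : Fin l → U,
    (∃ t, IsTreeIn φ k s.combs s.chains s'.type t ∧ ∀ σ, Sum.elim (t σ) b ∈ R) →
      ∃ b' : Fin l → U, (∀ i, b' i ∈ s'.params) ∧ {y | Sum.elim y b' ∈ R} ∈ s'.type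

/-- Take a tree satisfying a maximal admissible set. Its root becomes the new point and its left
half the new tree of nodes, while the right half witnesses that the next stage is good. Maximality
gives the clause `heir`. -/
theorem Stage.IsGood.exists_next [Nonempty U] {κ : Cardinal.{w}} (hU : IsSaturated L U κ)
    (hκ : Cardinal.lift.{w} (max ℵ₀ L.card) < Cardinal.lift.{max u v} κ) (hκ' : ℵ₀ ≤ κ)
    {s : Stage U m} (hs : s.IsGood φ k) :
    ∃ (s' : Stage U m) (B : List Bool → Fin m → U) (a : Fin m → U),
      s'.IsGood φ k ∧ s.Next φ k s' B a := by
  obtain ⟨G, hG, hmax⟩ := exists_maximal_isAdmissible hU hκ hκ' hs.few hs.combs_mem hs.chains_mem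
    hs.definable hs.exists_tree
  obtain ⟨t, ht, htG⟩ := hG.exists_tree
  let P : Set U := (s.params ∪ ⋃ g ∈ G, Set.range g.2.2) ∪
    (Set.range (t []) ∪ Set.range fun x : List Bool × Fin m => t (false :: x.1) x.2)
  have hP : s.params ⊆ P := Set.subset_union_left.trans Set.subset_union_left
  have hroot : ∀ i, t [] i ∈ P := fun i => Or.inr (Or.inl ⟨i, rfl⟩)
  have hleft : ∀ σ i, t (false :: σ) i ∈ P := fun σ i => Or.inr (Or.inr ⟨(σ, i), rfl⟩)
  refine ⟨⟨P, s.combs ∪ {d | ∃ c ∈ s.combs, ∃ σ, d = c ++ [t (false :: σ)]},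
    s.chains ∪ {d | ∃ c ∈ s.chains, d = c ++ [t [] ]}, s.type ∪ Instance.slice '' G⟩,
    t ∘ List.cons false, t [], ⟨?_, ?_, ?_, ?_, t ∘ List.cons true, ht.right, ?_⟩,
    ⟨hP, Set.subset_union_left, Set.subset_union_left, Set.subset_union_left,
      ⟨ht.comp (IsTreeEmbedding.cons false), fun X hX σ => htG X hX _⟩, fun X hX => htG X hX [],
      hleft, hroot, fun c hc σ => Or.inr ⟨c, hc, σ, rfl⟩, fun c hc => Or.inr ⟨c, hc, rfl⟩, ?_⟩⟩
  · refine (hs.few.union (hs.few.of_functional hG.definable hG.functional).biUnion_range).union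
      (FewParams.of_countable ?_)
    exact (Set.countable_range _).union (Set.countable_range _)
  · rintro d (hd | ⟨c, hc, σ, rfl⟩) y hy i
    · exact hP (hs.combs_mem d hd y hy i)
    · rcases List.mem_append.1 hy with hy | hy
      · exact hP (hs.combs_mem c hc y hy i)
      · rw [List.mem_singleton.1 hy]
        exact hleft σ i
  · rintro d (hd | ⟨c, hc, rfl⟩) y hy i
    · exact hP (hs.chains_mem d hd y hy i)
    · rcases List.mem_append.1 hy with hy | hy
      · exact hP (hs.chains_mem c hc y hy i)
      · rw [List.mem_singleton.1 hy]
        exact hroot i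
  · rintro X (hX | ⟨g, hg, rfl⟩)
    · exact (hs.definable X hX).mono hP
    · exact definable_slice (hG.definable g hg) hP
        fun i => Or.inl (Or.inr (Set.mem_biUnion hg (Set.mem_range_self i)))
  · exact fun X hX σ => htG X hX _
  · intro l R hR b hb
    obtain ⟨b', hb'⟩ := hmax l R hR b hb
    exact ⟨b', fun i => Or.inl (Or.inr (Set.mem_biUnion hb' ⟨i, rfl⟩)), Or.inr ⟨_, hb', rfl⟩⟩

/-- A sequence of stages, each of which extends the previous one. -/
theorem exists_stages [Nonempty U] {κ : Cardinal.{w}} (hU : IsSaturated L U κ)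
    (hκ : Cardinal.lift.{w} (max ℵ₀ L.card) < Cardinal.lift.{max u v} κ) (hκ' : ℵ₀ ≤ κ)
    {b : List Bool → Fin m → U} (hb : IsCombTree φ k {[]} {[]} b) :
    ∃ (s : ℕ → Stage U m) (B : ℕ → List Bool → Fin m → U) (a : ℕ → Fin m → U),
      [] ∈ (s 0).combs ∧ [] ∈ (s 0).chains ∧ (∀ j, (s j).IsGood φ k) ∧
        ∀ j, (s j).Next φ k (s (j + 1)) (B j) (a j) := by
  have step : ∀ s : {s : Stage U m // s.IsGood φ k}, ∃ (s' : {s : Stage U m // s.IsGood φ k})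
      (B : List Bool → Fin m → U) (a : Fin m → U), s.1.Next φ k s'.1 B a := by
    rintro ⟨s, hs⟩
    obtain ⟨s', B, a, hs', h⟩ := hs.exists_next hU hκ hκ'
    exact ⟨⟨s', hs'⟩, B, a, h⟩
  choose f B a hf using step
  have h0 : (⟨∅, {[]}, {[]}, ∅⟩ : Stage U m).IsGood φ k :=
    ⟨FewParams.of_countable Set.countable_empty, by simp, by simp, by simp, b, hb, by simp⟩
  let s : ℕ → {s : Stage U m // s.IsGood φ k} := fun j => f^[j] ⟨_, h0⟩
  refine ⟨fun j => (s j).1, fun j => B (s j), fun j => a (s j), rfl, rfl, fun j => (s j).2,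
    fun j => ?_⟩
  have : s (j + 1) = f (s j) := Function.iterate_succ_apply' f j _
  change (s j).1.Next φ k (s (j + 1)).1 _ _
  rw [this]
  exact hf (s j)

end Stages

/-! ### The heir-coheir and the coheir obtained from CTP -/

section Construction

variable {L : FirstOrder.Language.{u, v}} {U : Type w} [L.Structure U] {n m : ℕ}

/-- A set meeting all nonempty sets definable over it is an elementary substructure. -/
theorem exists_elementarySubstructure_of_definable (M : Set U)
    (h : ∀ Z : Set (Fin 1 → U), M.Definable L Z → Z.Nonempty → ∃ y ∈ Z, y 0 ∈ M) :
    ∃ S : L.ElementarySubstructure U, (S : Set U) = M := by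
  let S : L.Substructure U :=
    { carrier := M
      fun_mem := by
        intro l f x hx
        obtain ⟨y, hy, hyM⟩ := h _ (definable_realize_elim
          (Term.equal (Term.var (Sum.inl 0)) (Term.func f fun i => Term.var (Sum.inr i)) :
            L.Formula (Fin 1 ⊕ Fin l)) hx)
          ⟨fun _ => Structure.funMap f x, by simp⟩
        have : y 0 = Structure.funMap f x := by simpa using hy
        exact this ▸ hyM }
  have hS : S.IsElementary := by
    refine S.isElementary_of_exists fun l ψ x a ha => ?_
    let g : Empty ⊕ Fin (l + 1) → Fin 1 ⊕ Fin l :=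
      Sum.elim Empty.elim (Fin.snoc (α := fun _ => Fin 1 ⊕ Fin l) Sum.inr (Sum.inl 0))
    have key : ∀ y : Fin 1 → U, (ψ.toFormula.relabel g).Realize
        (Sum.elim y fun i => (x i : U)) ↔
        ψ.Realize default (Fin.snoc ((↑) ∘ x) (y 0) : Fin (l + 1) → U) := by
      intro y
      rw [Formula.realize_relabel, BoundedFormula.realize_toFormula]
      have h1 : ((Sum.elim y fun i => (x i : U)) ∘ g) ∘ Sum.inr =
          (Fin.snoc ((↑) ∘ x) (y 0) : Fin (l + 1) → U) := by
        funext i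
        refine Fin.lastCases ?_ (fun i => ?_) i <;> simp [g]
      rw [h1, Subsingleton.elim (((Sum.elim y fun i => (x i : U)) ∘ g) ∘ Sum.inl) default]
    obtain ⟨y, hy, hyM⟩ := h _ (definable_realize_elim (ψ.toFormula.relabel g)
      (b := fun i => (x i : U)) fun i => (x i).2) ⟨fun _ => a, (key _).2 ha⟩
    exact ⟨⟨y 0, hyM⟩, (key y).1 hy⟩
  exact ⟨⟨S, hS⟩, rfl⟩

theorem exists_definable_of_iUnion {A : ℕ → Set U} (hA : Monotone A) {α : Type} {Z : Set (α → U)}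
    (hZ : (⋃ j, A j).Definable L Z) : ∃ j, (A j).Definable L Z := by
  obtain ⟨l, φ, c, hc, rfl⟩ := definable_iff_exists_params.1 hZ
  choose f hf using fun i => Set.mem_iUnion.1 (hc i)
  obtain ⟨j, hj⟩ := (Filter.eventually_all.2 fun i => Filter.eventually_ge_atTop (f i)).exists
  exact ⟨j, definable_realize_elim φ fun i => hA (hj i) (hf i)⟩

/-- If `D`-almost every tuple can be appended to each list in `K`, then solvability passes from the
lists in `K` to their extensions by Morley lists. -/
theorem MorleyList.solvable_append_iff {φ : L.Formula (Fin n ⊕ Fin m)}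
    {D : Ultrafilter (Fin m → U)} {A : Set U} {K : Set (List (Fin m → U))} {P : Prop}
    {r : ℕ → Prop} (hKA : ∀ c ∈ K, ∀ y ∈ c, ∀ i, y i ∈ A)
    (hK : ∀ c ∈ K, {y | c ++ [y] ∈ K} ∈ D) (hP : ∀ c ∈ K, r c.length → (Solvable φ c ↔ P))
    {l : List (Fin m → U)} (hl : MorleyList L D A l) :
    ∀ c ∈ K, r (c.length + l.length) → (Solvable φ (c ++ l) ↔ P) := by
  induction l with
  | nil => simpa using hP
  | cons e l ih =>
    intro c hc hr
    have hdef : (A ∪ listParams l).Definable L {y : Fin m → U | Solvable φ (c ++ y :: l)} :=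
      definable_solvable_insert φ (fun y hy i => Or.inl (hKA c hc y hy i))
        fun y hy i => Or.inr ⟨y, hy, i, rfl⟩
    -- The latest member e realizes D over c and l, so it may be replaced by almost every y; such a
    -- y is absorbed into the list from K, leaving a shorter Morley list.
    have h1 : {y | Solvable φ (c ++ y :: l) ↔ P} ∈ D := by
      refine Filter.mem_of_superset (hK c hc) fun y hy => ?_
      have hlen : (c ++ [y]).length + l.length = c.length + (e :: l).length := by
        simp only [List.length_append, List.length_cons, List.length_nil]
        omega
      have := ih hl.2 (c ++ [y]) hy (hlen ▸ hr)
      rwa [List.append_assoc, List.singleton_append] at this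
    refine (hl.1.iff hdef).trans ⟨fun h2 => ?_, fun h2 => ?_⟩
    · obtain ⟨y, hy1, hy2⟩ := Ultrafilter.nonempty_of_mem (Filter.inter_mem h1 h2)
      exact hy1.1 hy2
    · exact Filter.mem_of_superset h1 fun y hy => hy.2 h2

/-- The comb tree property yields a failure of Kim's lemma for an heir-coheir. -/
theorem exists_isHeirCoheir_of_isCombTree [Nonempty U] {κ : Cardinal.{w}} (hU : IsSaturated L U κ)
    (hκ : Cardinal.lift.{w} (max ℵ₀ L.card) < Cardinal.lift.{max u v} κ) (hκ' : ℵ₀ ≤ κ)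
    {φ : L.Formula (Fin n ⊕ Fin m)} {k : ℕ} {b : List Bool → Fin m → U}
    (hb : IsCombTree φ k {[]} {[]} b) :
    ∃ (M : L.ElementarySubstructure U) (_ : #M < κ) (p q : GlobalType L U m),
      p.IsHeirCoheir (M : Set U) ∧ q.IsCoheir (M : Set U) ∧ p.EqOn q (M : Set U) ∧
        q.KimDivides (M : Set U) φ ∧ ¬ p.KimDivides (M : Set U) φ := by
  obtain ⟨s, B, a, hC0, hQ0, hgood, hnext⟩ := exists_stages hU hκ hκ' hb
  have hparams : Monotone fun j => (s j).params :=
    monotone_nat_of_le_succ fun j => (hnext j).params_subset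
  have htype : Monotone fun j => (s j).type :=
    monotone_nat_of_le_succ fun j => (hnext j).type_subset
  have hcombs : Monotone fun j => (s j).combs :=
    monotone_nat_of_le_succ fun j => (hnext j).combs_subset
  have hchains : Monotone fun j => (s j).chains :=
    monotone_nat_of_le_succ fun j => (hnext j).chains_subset
  have hdef : ∀ {α : Type} {Z : Set (α → U)}, (⋃ j, (s j).params).Definable L Z →
      ∃ j, (s j).params.Definable L Z := fun hZ => exists_definable_of_iUnion hparams hZ
  obtain ⟨M, hM⟩ : ∃ M : L.ElementarySubstructure U, (M : Set U) = ⋃ j, (s j).params := by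
    refine exists_elementarySubstructure_of_definable _ fun Z hZ hne => ?_
    obtain ⟨z, hz⟩ := hne
    obtain ⟨j, hj⟩ := hdef hZ
    -- The relation ignores y, so every tree satisfies it with parameter z; the heir clause then
    -- acts as the Tarski–Vaught test.
    obtain ⟨b', hb'M, hb'⟩ := (hnext j).heir 1 _ (hj.preimage_comp Sum.inr) z
      ⟨B j, (hnext j).isTreeIn, fun σ => hz⟩
    exact ⟨b', (hnext j).mem _ hb', Set.mem_iUnion.2 ⟨j + 1, hb'M 0⟩⟩
  have hMκ : #(M : Set U) < κ := by
    rw [hM]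
    exact (FewParams.iUnion_nat fun j => (hgood j).few).lt hκ
  have hBM : ∀ j σ i, B j σ i ∈ (M : Set U) := fun j σ i =>
    hM ▸ Set.mem_iUnion.2 ⟨j + 1, (hnext j).tree_mem σ i⟩
  have haM : ∀ j i, a j i ∈ (M : Set U) := fun j i =>
    hM ▸ Set.mem_iUnion.2 ⟨j + 1, (hnext j).point_mem i⟩
  -- the sets containing no tree at a given stage
  let thin : ℕ → Set (Fin m → U) → Prop := fun j Z =>
    ¬ ∃ t, IsTreeIn φ k (s j).combs (s j).chains (s (j + 1)).type t ∧ ∀ σ, t σ ∈ Z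
  have thin_mono : ∀ {i j} {Z}, i ≤ j → thin i Z → thin j Z := by
    rintro i j Z hij hi ⟨t, ht, htZ⟩
    exact hi ⟨t, ⟨ht.1.mono (hcombs hij) (hchains hij),
      fun X hX => ht.2 X (htype (Nat.succ_le_succ hij) hX)⟩, htZ⟩
  have thin_union : ∀ {j Z Z'}, thin j Z → thin j Z' → thin j (Z ∪ Z') := by
    rintro j Z Z' hZ hZ' ⟨t, ht, htZ⟩
    obtain ⟨g, hg, h | h⟩ := ht.1.exists_sub_or htZ
    · exact hZ ⟨t ∘ g, ⟨hg, fun X hX σ => ht.2 X hX _⟩, h⟩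
    · exact hZ' ⟨t ∘ g, ⟨hg, fun X hX σ => ht.2 X hX _⟩, h⟩
  let tail : ℕ → Set (Fin m → U) := fun j => {y | ∃ i ≥ j, ∃ σ, y = B i σ}
  have tail_anti : ∀ {i j}, i ≤ j → tail j ⊆ tail i := by
    rintro i j hij _ ⟨i', hi', σ, rfl⟩
    exact ⟨i', hij.trans hi', σ, rfl⟩
  -- D contains all tails of the left halves and avoids every set that is thin at some stage.
  obtain ⟨D, hD⟩ := exists_ultrafilter_of_inter
    {W : Set (Fin m → U) | ∃ j Z, thin j Z ∧ W = tail j \ Z}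
    ⟨_, 0, ∅, fun ⟨t, _, ht⟩ => ht [], rfl⟩
    (by
      rintro _ ⟨i, Z, hZ, rfl⟩ _ ⟨j, Z', hZ', rfl⟩
      refine ⟨max i j, Z ∪ Z', thin_union (thin_mono (le_max_left _ _) hZ)
        (thin_mono (le_max_right _ _) hZ'), ?_⟩
      ext y
      constructor
      · rintro ⟨⟨⟨i', hi', σ, rfl⟩, h1⟩, ⟨j', hj', τ, h2⟩, h3⟩
        refine ⟨?_, fun h => h.elim h1 h3⟩
        rcases le_total i j with hij | hij
        · exact ⟨j', by simpa [hij] using hj', τ, h2⟩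
        · exact ⟨i', by simpa [hij] using hi', σ, rfl⟩
      · rintro ⟨h1, h2⟩
        exact ⟨⟨tail_anti (le_max_left _ _) h1, fun h => h2 (Or.inl h)⟩,
          tail_anti (le_max_right _ _) h1, fun h => h2 (Or.inr h)⟩)
    (by
      rintro _ ⟨j, Z, hZ, rfl⟩
      by_contra hn
      -- If Z covered the tail, the tree `B j` would lie in Z, which is thin.
      refine hZ ⟨B j, (hnext j).isTreeIn, fun σ => ?_⟩
      by_contra hσ
      exact hn ⟨B j σ, ⟨j, le_rfl, σ, rfl⟩, hσ⟩)
  have thin_empty : ∀ j, thin j ∅ := fun j ⟨t, _, ht⟩ => ht []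
  have htail : ∀ j, tail j ∈ D := fun j =>
    Filter.mem_of_superset (hD _ ⟨j, ∅, thin_empty j, rfl⟩) Set.sdiff_subset
  have hthick : ∀ Z ∈ D, ∀ j, ∃ t,
      IsTreeIn φ k (s j).combs (s j).chains (s (j + 1)).type t ∧ ∀ σ, t σ ∈ Z := by
    intro Z hZ j
    by_contra hn
    obtain ⟨y, hy1, hy2⟩ := Ultrafilter.nonempty_of_mem
      (Filter.inter_mem hZ (hD _ ⟨j, Z, hn, rfl⟩))
    exact hy2.2 hy1
  have htypeD : ∀ j, ∀ X ∈ (s j).type, X ∈ D := by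
    intro j X hX
    refine Filter.mem_of_superset (htail j) ?_
    rintro _ ⟨i, hi, σ, rfl⟩
    exact (hnext i).isTreeIn.2 X (htype (hi.le.trans i.le_succ) hX) σ
  -- A D-large fibre contains a tree relative to the contexts of stage j inside the partial type of
  -- stage j + 1, which is exactly the situation decided by maximality.
  have hheir : ∀ (l : ℕ) (R : Set (Fin m ⊕ Fin l → U)) (j : ℕ), (s j).params.Definable L R →
      ∀ b : Fin l → U, {y | Sum.elim y b ∈ R} ∈ D → ∃ b' : Fin l → U,
        (∀ i, b' i ∈ (s (j + 1)).params) ∧ {y | Sum.elim y b' ∈ R} ∈ (s (j + 1)).type :=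
    fun l R j hR b hRb => (hnext j).heir l R hR b (hthick _ hRb j)
  let E : Ultrafilter (Fin m → U) := (Filter.hyperfilter ℕ).map a
  have hE : ∀ {Z : Set (Fin m → U)} {j : ℕ}, (∀ i ≥ j, a i ∈ Z) → Z ∈ E := by
    intro Z j h
    refine Filter.mem_hyperfilter_of_finite_compl ?_
    refine (Set.finite_lt_nat j).subset fun i hi => ?_
    by_contra hij
    exact hi (h i (not_lt.1 hij))
  have hDE : ∀ Z : Set (Fin m → U), (M : Set U).Definable L Z → Z ∈ D → Z ∈ E := by
    intro Z hZ hZD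
    rw [hM] at hZ
    obtain ⟨j, hj⟩ := hdef hZ
    -- With the empty tuple of extra variables, the heir clause puts a D-large set definable over M
    -- into the partial type of some stage, hence into E.
    have heq : ∀ b : Fin 0 → U,
        {y : Fin m → U | Sum.elim y b ∈ (fun g => g ∘ Sum.inl) ⁻¹' Z} = Z := fun b => by
      ext y
      simp
    obtain ⟨b', -, hb'⟩ := hheir 0 _ j (hj.preimage_comp Sum.inl) Fin.elim0 (by rwa [heq])
    rw [heq] at hb'
    exact hE (j := j) fun i hi => (hnext i).mem Z (htype (Nat.succ_le_succ hi) hb')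
  obtain ⟨p, hp⟩ := exists_globalType_of_ultrafilter (L := L) D
  obtain ⟨q, hq⟩ := exists_globalType_of_ultrafilter (L := L) E
  refine ⟨M, hMκ, p, q, ⟨?_, ?_⟩, ?_, ?_, ?_, ?_⟩
  · rw [hp.isHeir_iff]
    intro l R hR b hRb
    rw [hM] at hR
    obtain ⟨j, hj⟩ := hdef hR
    obtain ⟨b', hb', hb'D⟩ := hheir l R j hj b hRb
    exact ⟨b', fun i => hM ▸ Set.mem_iUnion.2 ⟨j + 1, hb' i⟩, htypeD _ _ hb'D⟩
  · rw [hp.isCoheir_iff]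
    intro Z _ hZD
    obtain ⟨y, hy1, i, -, σ, rfl⟩ := Ultrafilter.nonempty_of_mem (Filter.inter_mem hZD (htail 0))
    exact ⟨_, hy1, hBM i σ⟩
  · rw [hq.isCoheir_iff]
    intro Z _ hZE
    obtain ⟨i, hi⟩ := Ultrafilter.nonempty_of_mem (Ultrafilter.mem_map.1 hZE)
    exact ⟨a i, hi, haM i⟩
  · rw [hp.eqOn_iff hq]
    refine fun Z hZ => ⟨hDE Z hZ, fun hZE => ?_⟩
    by_contra hn
    exact Ultrafilter.compl_mem_iff_notMem.1
      (hDE _ hZ.compl (Ultrafilter.compl_mem_iff_notMem.2 hn)) hZE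
  · obtain ⟨e, he⟩ := hU.exists_morley hκ' hMκ E
    refine ⟨e, (isMorley_iff hq).2 he, not_consistent_of_not_solvable (N := k) ?_⟩
    -- Any chain context can be extended by all late a_i, and a context of length k is inconsistent:
    -- apply the tree condition to the empty chain.
    have := (MorleyList.of_seq he k).solvable_append_iff (φ := φ) (P := False) (r := (· = k))
      (K := ⋃ j, (s j).chains) ?_ ?_ ?_ [] (Set.mem_iUnion.2 ⟨0, hQ0⟩) (by simp)
    · simpa using this
    · intro c hc y hy i
      obtain ⟨j, hj⟩ := Set.mem_iUnion.1 hc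
      exact hM ▸ Set.mem_iUnion.2 ⟨j, (hgood j).chains_mem c hj y hy i⟩
    · intro c hc
      obtain ⟨j, hj⟩ := Set.mem_iUnion.1 hc
      exact hE (j := j) fun i hi =>
        Set.mem_iUnion.2 ⟨i + 1, (hnext i).append_point c (hchains hi hj)⟩
    · intro c hc hk
      obtain ⟨j, hj⟩ := Set.mem_iUnion.1 hc
      obtain ⟨t, ht⟩ := (hgood j).exists_tree
      have := ht.1.2 c hj [] List.Pairwise.nil (by simpa using hk)
      simpa using this
  · rintro ⟨e, he, hec⟩
    obtain ⟨N, hN⟩ := exists_not_solvable_of_not_consistent hec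
    -- Any comb context can be extended by every node of a late left half, and every context is
    -- consistent by the tree condition for the empty comb.
    have := (MorleyList.of_seq ((isMorley_iff hp).1 he) N).solvable_append_iff (φ := φ)
      (P := True) (r := fun _ => True) (K := ⋃ j, (s j).combs) ?_ ?_ ?_ []
      (Set.mem_iUnion.2 ⟨0, hC0⟩) trivial
    · exact hN (by simpa using this)
    · intro c hc y hy i
      obtain ⟨j, hj⟩ := Set.mem_iUnion.1 hc
      exact hM ▸ Set.mem_iUnion.2 ⟨j, (hgood j).combs_mem c hj y hy i⟩
    · intro c hc
      obtain ⟨j, hj⟩ := Set.mem_iUnion.1 hc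
      refine Filter.mem_of_superset (htail j) ?_
      rintro _ ⟨i, hi, σ, rfl⟩
      exact Set.mem_iUnion.2 ⟨i + 1, (hnext i).append_tree c (hcombs hi hj) σ⟩
    · intro c hc _
      obtain ⟨j, hj⟩ := Set.mem_iUnion.1 hc
      obtain ⟨t, ht⟩ := (hgood j).exists_tree
      have := ht.1.1 c hj [] CombList.nil
      simpa using this

end Construction

end CombTree

/-! ### The main theorem -/

theorem mainTheorem1 {L : FirstOrder.Language.{u, v}} (T : L.Theory) (hT : T.IsComplete)
    (U : Type w) [L.Structure U] [Nonempty U] [U ⊨ T] (κ : Cardinal.{w})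
    (hκ : Cardinal.lift.{w} (max ℵ₀ L.card) < Cardinal.lift.{max u v} κ)
    (hU : CombTree.IsSaturated L U κ) :
    (CombTree.HasCTP T ↔
      ∃ (M : L.ElementarySubstructure U) (_ : #M < κ) (n m : ℕ) (φ : L.Formula (Fin n ⊕ Fin m))
        (p q : CombTree.GlobalType L U m),
        p.IsHeirCoheir (M : Set U) ∧ q.IsCoheir (M : Set U) ∧ p.EqOn q (M : Set U) ∧
          q.KimDivides (M : Set U) φ ∧ ¬ p.KimDivides (M : Set U) φ) ∧
    (¬ CombTree.HasCTP T ↔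
      ∀ (M : L.ElementarySubstructure U), #M < κ → ∀ (n m : ℕ) (φ : L.Formula (Fin n ⊕ Fin m))
        (p q : CombTree.GlobalType L U m),
        p.IsHeirCoheir (M : Set U) → q.IsCoheir (M : Set U) → p.EqOn q (M : Set U) →
          q.KimDivides (M : Set U) φ → p.KimDivides (M : Set U) φ) ∧
    (¬ CombTree.HasCTP T ↔
      ∀ (M : L.ElementarySubstructure U), #M < κ → ∀ (n m : ℕ) (φ : L.Formula (Fin n ⊕ Fin m))
        (p q : CombTree.GlobalType L U m),
        p.IsBiInvariant (M : Set U) → q.IsInvariant (M : Set U) → p.EqOn q (M : Set U) →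
          q.KimDivides (M : Set U) φ → p.KimDivides (M : Set U) φ) := by
  have hκ' : ℵ₀ ≤ κ := Cardinal.aleph0_le_lift.1 (CombTree.aleph0_le_lift_card.trans hκ.le)
  have h1 : CombTree.HasCTP T →
      ∃ (M : L.ElementarySubstructure U) (_ : #M < κ) (n m : ℕ) (φ : L.Formula (Fin n ⊕ Fin m))
        (p q : CombTree.GlobalType L U m),
        p.IsHeirCoheir (M : Set U) ∧ q.IsCoheir (M : Set U) ∧ p.EqOn q (M : Set U) ∧
          q.KimDivides (M : Set U) φ ∧ ¬ p.KimDivides (M : Set U) φ := by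
    rintro ⟨k, hk⟩
    obtain ⟨n, m, φ, b, hb⟩ := hk.exists_isCombTree hT hU hκ'
    obtain ⟨M, hM, p, q, h⟩ := CombTree.exists_isHeirCoheir_of_isCombTree hU hκ hκ' hb
    exact ⟨M, hM, n, m, φ, p, q, h⟩
  have h2 : ∀ (M : L.ElementarySubstructure U), #M < κ → ∀ (n m : ℕ)
      (φ : L.Formula (Fin n ⊕ Fin m)) (p q : CombTree.GlobalType L U m),
      p.IsBiInvariant (M : Set U) → q.IsInvariant (M : Set U) → p.EqOn q (M : Set U) →
        q.KimDivides (M : Set U) φ → ¬ p.KimDivides (M : Set U) φ → CombTree.HasCTP T :=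
    fun M hM n m φ p q hp hq hpq hqφ hpφ =>
      CombTree.hasCTP_of_isBiInvariant hU hκ' hM hp hq hpq hqφ hpφ
  -- CTP produces a failure of the most special kind (heir-coheir and coheir), while a failure of
  -- the most general kind (bi-invariant and invariant) already produces CTP, so all the
  -- equivalences follow.
  refine ⟨⟨h1, ?_⟩, ⟨?_, ?_⟩, ?_, ?_⟩
  · rintro ⟨M, hM, n, m, φ, p, q, hp, hq, hpq, hqφ, hpφ⟩
    exact h2 M hM n m φ p q hp.isBiInvariant hq.isInvariant hpq hqφ hpφ
  · intro hT' M hM n m φ p q hp hq hpq hqφ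
    by_contra hpφ
    exact hT' (h2 M hM n m φ p q hp.isBiInvariant hq.isInvariant hpq hqφ hpφ)
  · intro h hT'
    obtain ⟨M, hM, n, m, φ, p, q, hp, hq, hpq, hqφ, hpφ⟩ := h1 hT'
    exact hpφ (h M hM n m φ p q hp hq hpq hqφ)
  · intro hT' M hM n m φ p q hp hq hpq hqφ
    by_contra hpφ
    exact hT' (h2 M hM n m φ p q hp hq hpq hqφ hpφ)
  · intro h hT'
    obtain ⟨M, hM, n, m, φ, p, q, hp, hq, hpq, hqφ, hpφ⟩ := h1 hT'
    exact hpφ (h M hM n m φ p q hp.isBiInvariant hq.isInvariant hpq hqφ)
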